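/- **Theorem 5.1 (Fundamental Theorem of the Theory of Relativity).** *Definitions.* Let $\mathcal E$ be a set (of events). A coordinate system (cs) is a bijection $\phi:\mathcal E\to\mathbb R^4\equiv\mathbb R^3\times\mathbb R$, $p\mapsto(\mathbf r(p),t(p))$; a space-time structure is a set $\Phi$ of cs's, called admissible. Let $\Sigma_S=\begin{pmatrix}S&0\\0&1\end{pmatrix}$ for $S\in SO(3)$, and $T_b(x)=x+b$ for $b\in\mathbb R^4$. A *worldline* is a set $\Gamma\subseteq\mathcal E$ such that for every $\phi\in\Phi$ there are a nondegenerate interval $I$ and a differentiable $\mathbf r:I\to\mathbb R^3$ with $\phi(\Gamma)=\{(\mathbf r(s),s):s\in I\}$; $d\mathbf r/ds$ is its *3-velocity* according to $\phi$, and $\Gamma$ is *uniform with respect to* $\phi$ if this is constant. A *point at rest* in $\phi$ is a set $\phi^{-1}(\{\mathbf r_0\}\times\mathbb R)$; $\phi'$ is *at rest* with respect to $\phi$ if all points at rest in $\phi'$ are at rest in $\phi$. The *velocity* of $\phi'$ with respect to $\phi$ is $\mathbf V$ if every point at rest in $\phi'$ has constant 3-velocity $\mathbf V$ according to $\phi$.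 $\hat{\mathcal V}_{\phi,p}\subseteq\mathbb R^3$ is the set of 3-velocities according to $\phi$ of the worldlines through $p$ that are uniform with respect to $\phi$. A linear map of $\mathbb R^4$ has *velocity* $\mathbf V$ if its matrix is $\begin{pmatrix}A&-A\mathbf V\\ \mathbf k^T&\alpha\end{pmatrix}$ with $\det A>0$, $\alpha>0$. A *special transformation* in the direction of the unit vector $\mathbf u$ is a linear map with matrix $\lambda\begin{pmatrix}I_3+(a-1)\mathbf u\mathbf u^T&-a\mathbf V\\ b\mathbf V^T&\hat\alpha\end{pmatrix}$, where $\mathbf V=v\mathbf u$, $v\in\mathbb R$, $a,\hat\alpha,\lambda>0$, $b\in\mathbb R$. *Theorem.* Let $\Phi$ be a space-time structure satisfying the following axioms. 1. $\Phi\neq\emptyset$. 2. For all $\phi,\phi'\in\Phi$ the transition function $\phi'\circ\phi^{-1}$ is a $C^2$ diffeomorphism of $\mathbb R^4$. 3. Every point at rest in an admissible cs is a worldline. 4. All admissible cs's define the same time order on all worldlines. 5. For all $\phi,\phi'\in\Phi$, writing $\phi'\circ\phi^{-1}:(\mathbf r,t)\mapsto(\mathbf r',t')$, one has $\det(\partial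 x'^\alpha/\partial x^\beta)_{\alpha,\beta=1,2,3}>0$ everywhere. 6. If $\phi,\phi'\in\Phi$ are mutually at rest, then $\phi'=T_b\circ\Sigma_S\circ\phi$ for some $S\in SO(3)$, $b\in\mathbb R^4$. 7. There is a subgroup $\mathcal G$ of the group of bijections of $\mathbb R^4$ (the *structure group*, which is unique) with $\Phi=\{g\circ\phi:g\in\mathcal G\}$ for some $\phi\in\Phi$. 8. For every $\phi\in\Phi$ and $p\in\mathcal E$, $\hat{\mathcal V}_{\phi,p}$ is a neighbourhood of $\mathbf 0$ that is star-shaped with respect to $\mathbf 0$. 9. For all $\phi,\phi'\in\Phi$, a worldline is uniform with respect to $\phi$ if and only if it is uniform with respect to $\phi'$; and $T_b\circ\phi\in\Phi$ for all $\phi\in\Phi$, $b\in\mathbb R^4$. 10. There are $\phi\in\Phi$ and $p\in\mathcal E$ such that every $\mathbf V$ in the interior of $\hat{\mathcal V}_{\phi,p}$ is the velocity with respect to $\phi$ of some $\phi'\in\Phi$, and conversely the velocity with respect to $\phi$ of every $\phi'\in\Phi$ lies in the interior of $\hat{\mathcal V}_{\phi,p}$. 11. There are a unit vector $\mathbf u\in\mathbb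 R^3$, an open interval $I\ni 0$ and a differentiable map $B$ from $I$ to the linear maps of $\mathbb R^4$ belonging to $\mathcal G$ such that $B(v)$ has velocity $v\mathbf u$ for all $v\in I$, $B(0)$ is the identity, and the image of $B$ is the set of all special transformations in the direction $\mathbf u$ belonging to $\mathcal G$. 12. $\Sigma_S\in\mathcal G$ for all $S\in SO(3)$. Then $\mathcal G$ is either the Galileo group, i.e. the group of all maps $(\mathbf r,t)\mapsto(S(\mathbf r-t\mathbf V),t)+b$ with $S\in SO(3)$, $\mathbf V\in\mathbb R^3$, $b\in\mathbb R^4$, or, for some $c>0$, the proper orthochronous Poincaré group with speed parameter $c$, i.e. the group of all maps $x\mapsto Lx+b$ with $b\in\mathbb R^4$ and $L$ a linear map that preserves $|\mathbf r|^2-c^2t^2$, has determinant $1$ and satisfies $\partial t'/\partial t>0$. -/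

import Mathlib

open Set Filter Topology

noncomputable section

namespace Relativity

/-- Euclidean 3-space. -/
abbrev R3 := EuclideanSpace ℝ (Fin 3)

/-- The coordinate space `ℝ⁴ ≡ ℝ³ × ℝ` (position, time). Only its vector space structure, topology
and differential structure are used. -/
abbrev R4 := R3 × ℝ

/-- The group `SO(3)`. -/
abbrev SO3 := Matrix.specialOrthogonalGroup (Fin 3) ℝ

/-- The linear map of `ℝ³` given by a `3 × 3` matrix. -/
abbrev act (A : Matrix (Fin 3) (Fin 3) ℝ) : R3 →L[ℝ] R3 := Matrix.toEuclideanCLM (𝕜 := ℝ) A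

/-- The linear map of `ℝ⁴` whose `4 × 4` matrix has rows of blocks `(A, w)` and `(kᵀ, α)`. -/
def blockMap (A : Matrix (Fin 3) (Fin 3) ℝ) (w k : R3) (α : ℝ) : R4 →L[ℝ] R4 :=
  ((act A).comp (ContinuousLinearMap.fst ℝ R3 ℝ)
      + (ContinuousLinearMap.snd ℝ R3 ℝ).smulRight w).prod
    ((innerSL ℝ k).comp (ContinuousLinearMap.fst ℝ R3 ℝ) + α • ContinuousLinearMap.snd ℝ R3 ℝ)

theorem blockMap_apply (A : Matrix (Fin 3) (Fin 3) ℝ) (w k : R3) (α : ℝ) (r : R3) (t : ℝ) :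
    blockMap A w k α (r, t) = (act A r + t • w, inner ℝ k r + α * t) := by
  simp [blockMap]

/-- The spatial rotation `Σ_S`, with rows of blocks `(S, 0)` and `(0ᵀ, 1)`. -/
def spatialRotation (S : Matrix (Fin 3) (Fin 3) ℝ) : R4 →L[ℝ] R4 := blockMap S 0 0 1

section SpaceTime

variable {E : Type*}

/-! Events form an arbitrary type `E`; a global coordinate system is a bijection `φ : E ≃ R4`, with
position function `p ↦ (φ p).1` and time function `p ↦ (φ p).2`. A space-time structure is a
nonempty set `Φ` of coordinate systems, called the admissible ones. -/

/-- The transition function `φ' ∘ φ⁻¹ : ℝ⁴ → ℝ⁴`. -/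
def transition (φ φ' : E ≃ R4) : R4 → R4 := fun x => φ' (φ.symm x)

/-- `r : I → ℝ³` represents the set of events `Γ` in the 3-space of `φ`: `I` is a nondegenerate
interval, `r` is differentiable on `I` and `φ(Γ)` is the inverted graph of `r`. -/
def Represents (φ : E ≃ R4) (Γ : Set E) (I : Set ℝ) (r : ℝ → R3) : Prop :=
  I.OrdConnected ∧ I.Nontrivial ∧ DifferentiableOn ℝ r I ∧ φ '' Γ = (fun s => (r s, s)) '' I

/-- A worldline: a curve that can be totally parametrized by the time coordinate of every
admissible coordinate system. -/
def IsWorldline (Φ : Set (E ≃ R4)) (Γ : Set E) : Prop :=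
  ∀ φ ∈ Φ, ∃ I r, Represents φ Γ I r

/-- According to `φ`, the curve `Γ` has 3-velocity constantly equal to `v`. -/
def HasConstantVelocity (φ : E ≃ R4) (Γ : Set E) (v : R3) : Prop :=
  ∃ I r, Represents φ Γ I r ∧ ∀ s ∈ I, HasDerivWithinAt r v I s

/-- The point at rest in `φ` with position `r₀`. -/
def restPoint (φ : E ≃ R4) (r₀ : R3) : Set E := range fun s : ℝ => φ.symm (r₀, s)

/-- `φ'` is at rest with respect to `φ`: all points at rest in `φ'` are at rest in `φ`. -/
def AtRest (φ φ' : E ≃ R4) : Prop := ∀ r₀', ∃ r₀, restPoint φ' r₀' = restPoint φ r₀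

/-- `Γ` is a worldline that is uniform with respect to `φ`. -/
def IsUniform (Φ : Set (E ≃ R4)) (φ : E ≃ R4) (Γ : Set E) : Prop :=
  IsWorldline Φ Γ ∧ ∃ v, HasConstantVelocity φ Γ v

/-- The set of 3-velocities, according to `φ`, of the worldlines through `p` that are uniform with
respect to `φ`. -/
def physicalVelocities (Φ : Set (E ≃ R4)) (φ : E ≃ R4) (p : E) : Set R3 :=
  {v | ∃ Γ : Set E, IsWorldline Φ Γ ∧ p ∈ Γ ∧ HasConstantVelocity φ Γ v}

/-- All worldlines that are uniform with respect to one of `φ`, `φ'` are uniform with respect to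
the other. -/
def InertiallyEquivalent (Φ : Set (E ≃ R4)) (φ φ' : E ≃ R4) : Prop :=
  ∀ Γ, IsUniform Φ φ Γ ↔ IsUniform Φ φ' Γ

/-- The velocity of `φ'` with respect to `φ` is `v`: according to `φ`, every point at rest in `φ'`
moves with constant 3-velocity `v`. -/
def HasVelocity (φ φ' : E ≃ R4) (v : R3) : Prop :=
  ∀ r₀', HasConstantVelocity φ (restPoint φ' r₀') v

/-- The Jacobian matrix `(∂x'^α / ∂x^β)`, `α, β = 1, 2, 3`, of the transition function, as a
linear map of `ℝ³`. -/
def spatialJacobian (φ φ' : E ≃ R4) (x : R4) : R3 →L[ℝ] R3 :=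
  (ContinuousLinearMap.fst ℝ R3 ℝ).comp
    ((fderiv ℝ (transition φ φ') x).comp (ContinuousLinearMap.inl ℝ R3 ℝ))

/-! ### The axioms -/

/-- Topology and differential structure: transition functions are `C²` diffeomorphisms (the
inverse of a transition function is again one). -/
def DifferentialStructure (Φ : Set (E ≃ R4)) : Prop :=
  ∀ φ ∈ Φ, ∀ φ' ∈ Φ, ContDiff ℝ 2 (transition φ φ')

/-- Causality: any point at rest in an admissible coordinate system is a worldline. -/
def Causality (Φ : Set (E ≃ R4)) : Prop :=
  ∀ φ ∈ Φ, ∀ r₀, IsWorldline Φ (restPoint φ r₀)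

/-- Time orientation: all admissible coordinate systems define the same time order on all
worldlines. -/
def TimeOrientation (Φ : Set (E ≃ R4)) : Prop :=
  ∀ φ ∈ Φ, ∀ φ' ∈ Φ, ∀ Γ, IsWorldline Φ Γ →
    ∀ p ∈ Γ, ∀ q ∈ Γ, (φ p).2 < (φ q).2 ↔ (φ' p).2 < (φ' q).2

/-- Spatial orientation: the spatial Jacobian determinant is everywhere positive, for every pair of
admissible coordinate systems. -/
def SpatialOrientation (Φ : Set (E ≃ R4)) : Prop :=
  ∀ φ ∈ Φ, ∀ φ' ∈ Φ, ∀ x, 0 < (spatialJacobian φ φ' x).det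

/-- Mutual rest: admissible coordinate systems that are mutually at rest differ by a spatial
rotation and a space-time translation. -/
def MutualRest (Φ : Set (E ≃ R4)) : Prop :=
  ∀ φ ∈ Φ, ∀ φ' ∈ Φ, AtRest φ φ' → AtRest φ' φ →
    ∃ S ∈ SO3, ∃ b : R4, ∀ p, φ' p = spatialRotation S (φ p) + b

/-- `G` is a structure group of `Φ`: `Φ` is the orbit `G · φ` of some `φ ∈ Φ` under composition. -/
def IsStructureGroup (Φ : Set (E ≃ R4)) (G : Subgroup (Equiv.Perm R4)) : Prop :=
  ∃ φ ∈ Φ, Φ = {ψ | ∃ g ∈ G, ψ = φ.trans g}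

/-- Physical velocities: for every admissible `φ` and every event `p`, the 3-velocities of the
`φ`-uniform worldlines through `p` form a star-shaped neighbourhood of `0`. -/
def PhysicalVelocities (Φ : Set (E ≃ R4)) : Prop :=
  ∀ φ ∈ Φ, ∀ p, StarConvex ℝ 0 (physicalVelocities Φ φ p) ∧ physicalVelocities Φ φ p ∈ 𝓝 0

/-- Inertiality: all admissible coordinate systems are inertially equivalent, and any coordinate
system that differs from an admissible one by a space-time translation is admissible. -/
def Inertiality (Φ : Set (E ≃ R4)) : Prop :=
  (∀ φ ∈ Φ, ∀ φ' ∈ Φ, InertiallyEquivalent Φ φ φ') ∧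
    ∀ φ ∈ Φ, ∀ b : R4, φ.trans (Equiv.addRight b) ∈ Φ

/-- Abundance of coordinate systems: for some admissible `φ` and some event `p`, the velocities
with respect to `φ` of admissible coordinate systems are exactly the interior points of the set of
physical velocities at `p`. -/
def Abundance (Φ : Set (E ≃ R4)) : Prop :=
  ∃ φ ∈ Φ, ∃ p : E,
    (∀ v ∈ interior (physicalVelocities Φ φ p), ∃ φ' ∈ Φ, HasVelocity φ φ' v) ∧
    ∀ φ' ∈ Φ, ∀ v, HasVelocity φ φ' v → v ∈ interior (physicalVelocities Φ φ p)

end SpaceTime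

/-- The linear map `L` belongs to the group `G` of bijections of `ℝ⁴`. -/
def InGroup (G : Subgroup (Equiv.Perm R4)) (L : R4 →L[ℝ] R4) : Prop :=
  ∃ g ∈ G, (g : R4 → R4) = L

/-- The velocity of the linear map `B` is `V`: the matrix of `B` has rows of blocks `(A, -A V)` and
`(kᵀ, α)`, with `det A > 0` and `α > 0`. -/
def HasMatrixVelocity (B : R4 →L[ℝ] R4) (V : R3) : Prop :=
  ∃ A k α, 0 < Matrix.det A ∧ 0 < α ∧ B = blockMap A (-(act A V)) k α

/-- `L` is a special transformation with velocity `V = v u`, where `u` is meant to be a unit vector: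
for some `a, α, lam > 0` and some `b` its matrix is `lam` times the matrix with rows of blocks
`(1 + (a - 1) u uᵀ, -a V)` and `(b Vᵀ, α)`. -/
def IsSpecial (u : R3) (v : ℝ) (L : R4 →L[ℝ] R4) : Prop :=
  ∃ a b α lam : ℝ, 0 < a ∧ 0 < α ∧ 0 < lam ∧
    L = lam • blockMap (1 + (a - 1) • Matrix.vecMulVec u u) (-(a • v • u)) (b • v • u) α

/-- Special transformations: for some unit vector `u` there is a differentiable map `B` from an
open interval `I` to `G` such that `B v` has velocity `v u`, `B 0` is the identity, and the image of
`B` consists of all the special transformations in the direction `u` belonging to `G`. -/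
def SpecialTransformations (G : Subgroup (Equiv.Perm R4)) : Prop :=
  ∃ u : R3, ‖u‖ = 1 ∧ ∃ (I : Set ℝ) (B : ℝ → R4 →L[ℝ] R4),
    IsOpen I ∧ I.OrdConnected ∧ 0 ∈ I ∧ DifferentiableOn ℝ B I ∧
    (∀ v ∈ I, InGroup G (B v) ∧ HasMatrixVelocity (B v) (v • u)) ∧
    B 0 = ContinuousLinearMap.id ℝ R4 ∧
    B '' I = {L | InGroup G L ∧ ∃ v, IsSpecial u v L}

/-- Spatial isotropy: `G` contains all spatial rotations. -/
def SpatialIsotropy (G : Subgroup (Equiv.Perm R4)) : Prop :=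
  ∀ S ∈ SO3, InGroup G (spatialRotation S)

/-! ### The two groups -/

/-- The (proper orthochronous, inhomogeneous) Galileo group: all maps
`(r, t) ↦ (S (r - t V), t) + b` with `S ∈ SO(3)`, `V ∈ ℝ³` and `b ∈ ℝ⁴`. -/
def galileoGroup : Set (Equiv.Perm R4) :=
  {g | ∃ S ∈ SO3, ∃ (V : R3) (b : R4), ∀ x, g x = blockMap S (-(act S V)) 0 1 x + b}

/-- The Minkowski quadratic form `|r|² - c² t²`. -/
def minkowskiForm (c : ℝ) (x : R4) : ℝ := ‖x.1‖ ^ 2 - c ^ 2 * x.2 ^ 2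

/-- The proper orthochronous Poincaré group with speed parameter `c`: all maps `x ↦ L x + b` with
`b ∈ ℝ⁴` and `L` a linear map that preserves the Minkowski form (a Lorentz transformation), has
determinant `1` (proper) and satisfies `∂t'/∂t > 0` (orthochronous). -/
def poincareGroup (c : ℝ) : Set (Equiv.Perm R4) :=
  {g | ∃ (L : R4 →L[ℝ] R4) (b : R4), (∀ x, minkowskiForm c (L x) = minkowskiForm c x) ∧
    L.det = 1 ∧ 0 < (L (0, 1)).2 ∧ ∀ x, g x = L x + b}

end Relativity

end

open Relativity

/-! Affinity. A worldline uniform in one admissible system is uniform in all, so a transition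
function f sends short straight pieces with directions (v,1), v near 0, into straight lines.
Infinitesimally, D²f(w,w) is parallel to Df(w) for these w. Pulled back by Df, this is a polynomial
condition on an open set of directions, hence valid for all w (`quadratic_parallel`). A Grönwall
argument then shows that f and its inverse send every line into a line, and a C² diffeomorphism of
this kind is affine (`affine_of_tangent_acceleration`). So the structure group consists of affine
maps and contains all translations; its linear elements of velocity 0 are rotations, by mutual rest.

Special transformations. Such a map is a scalar l on the plane orthogonal to u and a 2×2 matrix on
the span of u and the time axis. Conjugation by a half-turn reverses u, so the reversed inverse of a
special transformation in the group is again one. On velocities this gives a continuous,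
sign-preserving involution of an interval, which must be the identity. This reciprocity yields l =
1, equal diagonal entries and determinant 1 (`SpecialFamily.parameters`). The product of two such
maps is of the same kind; equality of its diagonal entries forces the lower left entry to be -κ p v
with a universal constant κ. The maps are therefore boosts. Composing a boost with itself produces
every velocity with κ v² < 1, and excludes κ < 0, where the boosts would be Euclidean rotations
mixing space and time (`SpecialFamily.exists_boost`).

Conclusion. Composition with a suitable boost shows that no velocity V in the group has κ|V|² > 1,
and openness of the set of velocities excludes κ|V|² = 1. Each linear element composed with the
boost opposite to its velocity is then at rest, so it is a rotation times a boost. The Galileo group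
(κ = 0) and the Poincaré group (κ = 1/c²) have this same normal form. -/

open Set Filter Topology

noncomputable section

namespace Relativity

open scoped RealInnerProductSpace

/-! ### Smooth maps that send lines into lines are affine -/

section Calculus

variable {V W : Type*} [NormedAddCommGroup V] [NormedSpace ℝ V]
  [NormedAddCommGroup W] [NormedSpace ℝ W]

/-- A nonzero vector `e` spans the kernel of some continuous linear map. -/
theorem exists_clm_ker_eq_span {e : W} (he : e ≠ 0) :
    ∃ N : W →L[ℝ] W, N e = 0 ∧ ∀ z, N z = 0 → ∃ c : ℝ, z = c • e := by
  obtain ⟨l, hl⟩ := SeparatingDual.exists_eq_one (R := ℝ) he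
  refine ⟨ContinuousLinearMap.id ℝ W - l.smulRight e, ?_, fun z hz => ⟨l z, ?_⟩⟩
  · simp [hl]
  · simpa [sub_eq_zero] using hz

theorem hasDerivAt_comp_line {f : V → W} (hf : ContDiff ℝ 2 f) (x w : V) (s : ℝ) :
    HasDerivAt (fun s : ℝ => f (x + s • w)) (fderiv ℝ f (x + s • w) w) s := by
  have h1 : HasDerivAt (fun s : ℝ => x + s • w) w s := by
    simpa using ((hasDerivAt_id s).smul_const w).const_add x
  exact ((hf.differentiable (by norm_num)) _).hasFDerivAt.comp_hasDerivAt s h1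

theorem hasDerivAt_fderiv_comp_line {f : V → W} (hf : ContDiff ℝ 2 f) (x w : V) (s : ℝ) :
    HasDerivAt (fun s : ℝ => fderiv ℝ f (x + s • w) w)
      (fderiv ℝ (fderiv ℝ f) (x + s • w) w w) s := by
  have h1 : HasDerivAt (fun s : ℝ => x + s • w) w s := by
    simpa using ((hasDerivAt_id s).smul_const w).const_add x
  have h2 : ContDiff ℝ 1 (fderiv ℝ f) := hf.fderiv_right (by norm_num)
  have h3 := ((h2.differentiable (by norm_num)) (x + s • w)).hasFDerivAt.comp_hasDerivAt s h1
  simpa using h3.clm_apply (hasDerivAt_const s w)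

/-- If the acceleration of the image of every line is tangent to it, then this image lies in
a line. -/
theorem image_line_of_tangent_acceleration {f : V → W} (hf : ContDiff ℝ 2 f)
    (hinj : ∀ x w, w ≠ 0 → fderiv ℝ f x w ≠ 0)
    (hacc : ∀ x w, ∃ c : ℝ, fderiv ℝ (fderiv ℝ f) x w w = c • fderiv ℝ f x w) (x w : V) :
    (∃ s : ℝ, f (x + w) = f x + s • fderiv ℝ f x w) ∧
      ∃ s : ℝ, fderiv ℝ f (x + w) w = s • fderiv ℝ f x w := by
  rcases eq_or_ne w 0 with rfl | hw
  · simp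
  obtain ⟨N, hN, hNker⟩ := exists_clm_ker_eq_span (hinj x w hw)
  set q' : ℝ → W := fun s => fderiv ℝ f (x + s • w) w with hq'
  set q'' : ℝ → W := fun s => fderiv ℝ (fderiv ℝ f) (x + s • w) w w with hq''
  have hq'0 : ∀ s, q' s ≠ 0 := fun s => hinj _ _ hw
  have h2 : ContDiff ℝ 1 (fderiv ℝ f) := hf.fderiv_right (by norm_num)
  have hcont' : Continuous q' := by
    have := h2.continuous
    fun_prop
  have hcont'' : Continuous q'' := by
    have := h2.continuous_fderiv (by norm_num)
    fun_prop
  -- The factor c with q'' = c q' is not known to be continuous, but |c| = ‖q''‖ / ‖q'‖ is, hence it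
  -- is bounded on [0, 1].
  have hK : Continuous fun s => ‖q'' s‖ / ‖q' s‖ :=
    hcont''.norm.div hcont'.norm fun s => norm_ne_zero_iff.2 (hq'0 s)
  obtain ⟨K, hKb⟩ := (isCompact_Icc (a := (0 : ℝ)) (b := 1)).exists_bound_of_continuousOn
    hK.continuousOn
  have hd : ∀ s, HasDerivAt (fun s => N (q' s)) (N (q'' s)) s := fun s =>
    N.hasFDerivAt.comp_hasDerivAt s (hasDerivAt_fderiv_comp_line hf x w s)
  -- Grönwall: N q' has derivative N q'' = c N q' with |c| ≤ K and vanishes at 0, so the velocity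
  -- never leaves the kernel of N, the line spanned by q' 0.
  have hzero : ∀ s ∈ Icc (0 : ℝ) 1, N (q' s) = 0 := by
    refine eq_zero_of_abs_deriv_le_mul_abs_self_of_eq_zero_right (K := K)
      (f' := fun s => N (q'' s)) ?_ (fun s _ => (hd s).hasDerivWithinAt) ?_ ?_
    · exact (N.continuous.comp hcont').continuousOn
    · simpa [hq'] using hN
    · intro s hs
      obtain ⟨c, hc⟩ := hacc (x + s • w) w
      have hc' : q'' s = c • q' s := hc
      have hKs := hKb s (Ico_subset_Icc_self hs)
      rw [hc', norm_smul, mul_div_assoc, div_self (norm_ne_zero_iff.2 (hq'0 s)), mul_one,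
        norm_norm] at hKs
      rw [hc', map_smul, norm_smul]
      exact mul_le_mul_of_nonneg_right hKs (norm_nonneg _)
  constructor
  · have hconst := (convex_Icc (0 : ℝ) 1).is_const_of_fderivWithin_eq_zero (𝕜 := ℝ)
      (f := fun s => N (f (x + s • w))) ?_ ?_ (x := 1) (y := 0) (by simp) (by simp)
    · obtain ⟨c, hc⟩ := hNker (f (x + w) - f x) (by simpa [sub_eq_zero] using hconst)
      exact ⟨c, by rw [← hc]; abel⟩
    · intro s _
      exact (N.hasFDerivAt.comp_hasDerivAt s
        (hasDerivAt_comp_line hf x w s)).differentiableAt.differentiableWithinAt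
    · intro s hs
      have h3 : HasDerivAt (fun s => N (f (x + s • w))) 0 s := by
        have := N.hasFDerivAt.comp_hasDerivAt s (hasDerivAt_comp_line hf x w s)
        rwa [hzero s hs] at this
      have h4 := h3.hasFDerivAt.hasFDerivWithinAt (s := Icc 0 1)
      have hu := uniqueDiffOn_Icc (zero_lt_one' ℝ) s hs
      rw [h4.fderivWithin hu]
      ext; simp
  · obtain ⟨c, hc⟩ := hNker (q' 1) (hzero 1 (by simp))
    exact ⟨c, by simpa [hq'] using hc⟩

/-- If a diffeomorphism and its inverse map lines into lines, then the images of parallel lines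
are parallel. -/
theorem fderiv_parallel_of_image_line {f : V → W} {g : W → V}
    (hgf : ∀ x, g (f x) = x)
    (hf : ∀ x w, (∃ s : ℝ, f (x + w) = f x + s • fderiv ℝ f x w) ∧
      ∃ s : ℝ, fderiv ℝ f (x + w) w = s • fderiv ℝ f x w)
    (hg : ∀ x w, ∃ s : ℝ, g (x + w) = g x + s • fderiv ℝ g x w)
    (hchain : ∀ x w, fderiv ℝ g (f x) (fderiv ℝ f x w) = w)
    (x y w : V) : ∃ s : ℝ, fderiv ℝ f y w = s • fderiv ℝ f x w := by
  rcases eq_or_ne w 0 with rfl | hw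
  · simp
  by_cases hdep : ∃ t : ℝ, y = x + t • w
  · obtain ⟨t, rfl⟩ := hdep
    rcases eq_or_ne t 0 with rfl | ht
    · exact ⟨1, by simp⟩
    obtain ⟨s, hs⟩ := (hf x (t • w)).2
    refine ⟨s, ?_⟩
    rw [map_smul, map_smul, smul_comm] at hs
    exact smul_right_injective W ht hs
  push Not at hdep
  set A := fderiv ℝ f x with hA
  obtain ⟨s, hs⟩ := (hf x (y - x)).1
  rw [add_sub_cancel] at hs
  obtain ⟨s', hs'⟩ := (hf x (y - x + w)).1
  obtain ⟨τ, hτ⟩ := (hf y w).1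
  have hyw : x + (y - x + w) = y + w := by abel
  rw [hyw] at hs'
  set d := fderiv ℝ f y w with hd
  have hτ0 : τ ≠ 0 := by
    rintro rfl
    have := congrArg g hτ
    simp [hgf] at this
    exact hw this
  have hdA : d = ((s' - s) / τ) • A (y - x) + (s' / τ) • A w := by
    have h1 : τ • d = (s' - s) • A (y - x) + s' • A w := by
      have : τ • d = f (y + w) - f y := by rw [hτ]; abel
      rw [this, hs', hs, map_add]
      module
    rw [← inv_smul_smul₀ hτ0 d, h1, smul_add, smul_smul, smul_smul]
    congr 2 <;> ring
  rcases eq_or_ne (s' - s) 0 with h0 | h0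
  · exact ⟨s' / τ, by rw [hdA, h0]; simp⟩
  exfalso
  -- If d had a component along A (y - x), the line through f y in direction d would meet the line
  -- through f x in direction A w, at parameter σ. Pulled back by g, the parallel lines through y
  -- and x in direction w would share a point, against `hdep`.
  set σ := -s / ((s' - s) / τ) with hσ
  have hz : f y + σ • d = f x + (σ * (s' / τ)) • A w := by
    have h3 : σ * ((s' - s) / τ) = -s := by rw [hσ]; field_simp
    rw [hs, hdA, smul_add, smul_smul, smul_smul, h3]
    module
  obtain ⟨s1, hs1⟩ := hg (f y) (σ • d)
  obtain ⟨s2, hs2⟩ := hg (f x) ((σ * (s' / τ)) • A w)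
  rw [hz, hs2, map_smul, map_smul, hchain, hchain, hgf, hgf] at hs1
  apply hdep (s2 * (σ * (s' / τ)) - s1 * σ)
  have : y = x + s2 • (σ * (s' / τ)) • w - s1 • σ • w := by rw [hs1]; abel
  rw [this]
  module

/-- A map with parallel image lines is affine. -/
theorem affine_of_parallel (hV : 1 < Module.finrank ℝ V) (f : V → W) (A : V →L[ℝ] W)
    (hA : Function.Injective A) (h : ∀ x w, ∃ k : ℝ, f (x + w) = f x + k • A w) :
    ∃ k : ℝ, ∀ x, f x = f 0 + (k • A) x := by
  choose k hk using h
  -- The point f (x + a + b) is reached via x + a, via x + b and directly; comparing coefficients of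
  -- the independent vectors A a and A b identifies the scale factors.
  have hind : ∀ x a b, LinearIndependent ℝ ![a, b] → k x a = k x b ∧ k (x + b) a = k x a := by
    intro x a b hab
    have hab' : LinearIndependent ℝ ![A a, A b] := by
      have := hab.map' (A : V →ₗ[ℝ] W) (LinearMap.ker_eq_bot.2 hA)
      have hc : ((A : V →ₗ[ℝ] W) ∘ ![a, b]) = ![A a, A b] := by
        ext i; fin_cases i <;> rfl
      rwa [hc] at this
    rw [LinearIndependent.pair_iff] at hab'
    have h1 : f (x + b + a) = f x + k x b • A b + k (x + b) a • A a := by rw [hk, hk]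
    have h2 : f (x + a + b) = f x + k x a • A a + k (x + a) b • A b := by rw [hk, hk]
    have h3 := hk x (a + b)
    rw [← add_assoc] at h3
    rw [add_right_comm] at h1
    rw [map_add] at h3
    have e1 := hab' (k x a - k x (a + b)) (k (x + a) b - k x (a + b)) (by
      have := h2.symm.trans h3
      rw [add_assoc, add_right_inj] at this
      rw [← sub_eq_zero] at this
      rw [← this]; module)
    have e2 := hab' (k (x + b) a - k x (a + b)) (k x b - k x (a + b)) (by
      have := h1.symm.trans h3
      rw [add_assoc, add_right_inj] at this
      rw [← sub_eq_zero] at this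
      rw [← this]; module)
    constructor <;> linarith [e1.1, e1.2, e2.1, e2.2]
  have hsame : ∀ x a b, a ≠ 0 → b ≠ 0 → k x a = k x b := by
    intro x a b ha hb
    by_cases hab : LinearIndependent ℝ ![a, b]
    · exact (hind x a b hab).1
    -- Dependent vectors are compared through a third one independent of both; this is where
    -- dimension at least 2 enters.
    obtain ⟨c, hc⟩ := exists_linearIndependent_pair_of_one_lt_finrank hV ha
    have hbc : LinearIndependent ℝ ![b, c] := by
      rw [LinearIndependent.pair_iff' ha] at hab hc
      push Not at hab
      obtain ⟨t, rfl⟩ := hab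
      have ht : t ≠ 0 := by rintro rfl; simp at hb
      rw [LinearIndependent.pair_iff' hb]
      intro s hs
      exact hc (s * t) (by rw [← hs, smul_smul])
    rw [(hind x a c hc).1, (hind x b c hbc).1]
  have hnt : Nontrivial V := Module.nontrivial_of_finrank_pos (R := ℝ) (by omega)
  obtain ⟨a, ha⟩ := exists_ne (0 : V)
  have hbase : ∀ b, k b a = k 0 a := by
    intro b
    rcases eq_or_ne b 0 with rfl | hb
    · rfl
    obtain ⟨c, hc⟩ := exists_linearIndependent_pair_of_one_lt_finrank hV hb
    have hc0 : c ≠ 0 := by simpa using hc.ne_zero 1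
    have hc' : LinearIndependent ℝ ![c, b] := LinearIndependent.pair_symm_iff.1 hc
    have := (hind 0 c b hc').2
    rw [zero_add] at this
    rw [hsame b a c ha hc0, this, hsame 0 a c ha hc0]
  refine ⟨k 0 a, fun x => ?_⟩
  rcases eq_or_ne x 0 with rfl | hx
  · simp
  have := hk 0 x
  rw [zero_add, hsame 0 x a hx ha] at this
  simpa using this

/-- A `C²` diffeomorphism such that the accelerations of the images of lines, under itself and
under its inverse, are tangent to them, is affine. -/
theorem affine_of_tangent_acceleration (hV : 1 < Module.finrank ℝ V) {f : V → W} {g : W → V}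
    (hf : ContDiff ℝ 2 f) (hg : ContDiff ℝ 2 g) (hgf : ∀ x, g (f x) = x) (hfg : ∀ x, f (g x) = x)
    (hfacc : ∀ x w, ∃ c : ℝ, fderiv ℝ (fderiv ℝ f) x w w = c • fderiv ℝ f x w)
    (hgacc : ∀ x w, ∃ c : ℝ, fderiv ℝ (fderiv ℝ g) x w w = c • fderiv ℝ g x w) :
    ∃ A : V →L[ℝ] W, ∀ x, f x = f 0 + A x := by
  have hdf : Differentiable ℝ f := hf.differentiable (by norm_num)
  have hdg : Differentiable ℝ g := hg.differentiable (by norm_num)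
  have hchain : ∀ x w, fderiv ℝ g (f x) (fderiv ℝ f x w) = w := by
    intro x w
    have h1 := ((hdg (f x)).hasFDerivAt.comp x (hdf x).hasFDerivAt)
    have h2 : g ∘ f = id := funext hgf
    rw [h2] at h1
    exact DFunLike.congr_fun (h1.unique (hasFDerivAt_id x)) w
  have hchain' : ∀ x w, fderiv ℝ f (g x) (fderiv ℝ g x w) = w := by
    intro x w
    have h1 := ((hdf (g x)).hasFDerivAt.comp x (hdg x).hasFDerivAt)
    have h2 : f ∘ g = id := funext hfg
    rw [h2] at h1
    exact DFunLike.congr_fun (h1.unique (hasFDerivAt_id x)) w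
  have hinj : ∀ x w, w ≠ 0 → fderiv ℝ f x w ≠ 0 := by
    intro x w hw h0
    apply hw
    rw [← hchain x w, h0, map_zero]
  have hinj' : ∀ x w, w ≠ 0 → fderiv ℝ g x w ≠ 0 := by
    intro x w hw h0
    apply hw
    rw [← hchain' x w, h0, map_zero]
  have hfl := image_line_of_tangent_acceleration hf hinj hfacc
  have hgl := image_line_of_tangent_acceleration hg hinj' hgacc
  have hpar := fderiv_parallel_of_image_line hgf hfl (fun x w => (hgl x w).1) hchain 0
  have hA : Function.Injective (fderiv ℝ f 0) := by
    rw [injective_iff_map_eq_zero]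
    intro w hw
    by_contra h0
    exact hinj 0 w h0 hw
  obtain ⟨k, hk⟩ := affine_of_parallel hV f (fderiv ℝ f 0) hA fun x w => by
    obtain ⟨s, hs⟩ := (hfl x w).1
    obtain ⟨t, ht⟩ := hpar x w
    exact ⟨s * t, by rw [hs, ht, smul_smul]⟩
  exact ⟨_, hk⟩

/-- A cubic polynomial that vanishes near `0` has zero coefficients. -/
theorem cubic_coeff_eq_zero {a b c d : ℝ}
    (h : ∀ᶠ s : ℝ in 𝓝 0, a + b * s + c * s ^ 2 + d * s ^ 3 = 0) :
    a = 0 ∧ b = 0 ∧ c = 0 ∧ d = 0 := by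
  obtain ⟨ε, hε, h⟩ := Metric.eventually_nhds_iff.1 h
  have key : ∀ x : ℝ, |x| < 1 → a + b * (ε * x) + c * (ε * x) ^ 2 + d * (ε * x) ^ 3 = 0 := by
    intro x hx
    apply h
    rw [Real.dist_eq, sub_zero, abs_mul, abs_of_pos hε]
    nlinarith
  have h0 := key 0 (by norm_num)
  have h1 := key (1 / 2) (by norm_num [abs_of_pos])
  have h2 := key (-1 / 2) (by norm_num [abs_of_neg])
  have h3 := key (1 / 4) (by norm_num [abs_of_pos])
  have ha : a = 0 := by linarith
  subst ha
  have hb : b * ε = 0 := by linarith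
  have hc : c * ε ^ 2 = 0 := by linarith
  have hd : d * ε ^ 3 = 0 := by linarith
  simp only [mul_eq_zero, hε.ne', pow_eq_zero_iff, or_false, ne_eq, OfNat.ofNat_ne_zero,
    not_false_eq_true] at hb hc hd
  exact ⟨rfl, hb, hc, hd⟩

end Calculus

/-- If the values of a quadratic map are parallel to the argument `(v, 1)` for small `v`, then
they are parallel to the argument everywhere. -/
theorem quadratic_parallel (B : R4 →L[ℝ] R4 →L[ℝ] R4)
    (h : ∀ᶠ v : R3 in 𝓝 0, ∃ c : ℝ, B (v, 1) (v, 1) = c • ((v, 1) : R4)) (w : R4) :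
    ∃ c : ℝ, B w w = c • w := by
  obtain ⟨v, τ⟩ := w
  set b0 := B (0, 1) (0, 1) with hb0
  set b1 := B (0, 1) (v, 0) + B (v, 0) (0, 1) with hb1
  set b2 := B (v, 0) (v, 0) with hb2
  have hexp : ∀ s t : ℝ, B (s • v, t) (s • v, t) = t ^ 2 • b0 + (t * s) • b1 + s ^ 2 • b2 := by
    intro s t
    have : ((s • v, t) : R4) = t • ((0, 1) : R4) + s • ((v, 0) : R4) := by simp
    rw [this]
    simp only [map_add, map_smul, add_apply, smul_apply,
      hb0, hb1, hb2]
    module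
  have hs : ∀ᶠ s : ℝ in 𝓝 0, ∃ c : ℝ, B (s • v, 1) (s • v, 1) = c • ((s • v, 1) : R4) := by
    have : Tendsto (fun s : ℝ => s • v) (𝓝 0) (𝓝 0) := by
      have : Continuous fun s : ℝ => s • v := by fun_prop
      simpa using this.tendsto 0
    exact this.eventually h
  -- The time component of the hypothesis at (s v, 1) determines c as a quadratic in s; inserted
  -- into the space components it leaves a cubic in s that vanishes near 0.
  have hcoef : ∀ i, b0.1 i = 0 ∧ b1.1 i - b0.2 * v i = 0 ∧ b2.1 i - b1.2 * v i = 0 ∧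
      -b2.2 * v i = 0 := by
    intro i
    apply cubic_coeff_eq_zero
    filter_upwards [hs] with s ⟨c, hc⟩
    rw [hexp] at hc
    have h2 := congrArg Prod.snd hc
    have h1 := congrArg (fun z : R4 => z.1 i) hc
    simp at h1 h2
    rw [← h2] at h1
    linarith
  have h0 : b0.1 = 0 := by ext i; simpa using (hcoef i).1
  have h1 : b1.1 = b0.2 • v := by ext i; simpa [sub_eq_zero] using (hcoef i).2.1
  have h2 : b2.1 = b1.2 • v := by ext i; simpa [sub_eq_zero] using (hcoef i).2.2.1
  have h3 : b2.2 • v = 0 := by ext i; simpa using (hcoef i).2.2.2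
  have hB := hexp 1 τ
  rw [one_smul] at hB
  rw [hB]
  rcases eq_or_ne v 0 with rfl | hv
  · refine ⟨τ * b0.2, ?_⟩
    have e1 : b1 = 0 := by
      rw [hb1]; simp [show ((0, 0) : R4) = 0 from rfl]
    have e2 : b2 = 0 := by
      rw [hb2]; simp [show ((0, 0) : R4) = 0 from rfl]
    rw [e1, e2]
    ext <;> simp [h0]; ring
  · have h4 : b2.2 = 0 := by simpa [hv] using h3
    refine ⟨τ * b0.2 + b1.2, ?_⟩
    refine Prod.ext ?_ ?_
    · simp [h0, h1, h2]; module
    · simp [h4]; ring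

/-! ### Uniform worldlines and affine transition functions -/

section Worldlines

variable {E : Type*}

theorem exists_Icc_subset_of_nontrivial {J : Set ℝ} (hJ : J.OrdConnected) (hJn : J.Nontrivial)
    {x : ℝ} (hx : x ∈ J) : ∃ a b : ℝ, a < b ∧ x ∈ Icc a b ∧ Icc a b ⊆ J := by
  obtain ⟨y, hy, hyx⟩ := hJn.exists_ne x
  rcases lt_or_gt_of_ne hyx with h | h
  · exact ⟨y, x, h, ⟨h.le, le_rfl⟩, hJ.out hy hx⟩
  · exact ⟨x, y, h, ⟨le_rfl, h.le⟩, hJ.out hx hy⟩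

theorem deriv_eq_zero_of_eqOn_Icc {W : Type*} [NormedAddCommGroup W] [NormedSpace ℝ W] {h : ℝ → W}
    {h' : W} {a b s : ℝ} (hab : a < b) (hz : ∀ s ∈ Icc a b, h s = 0) (hs : s ∈ Icc a b)
    (hd : HasDerivAt h h' s) : h' = 0 :=
  (uniqueDiffOn_Icc hab s hs).eq_deriv _ hd.hasDerivWithinAt
    ((hasDerivWithinAt_const s (Icc a b) (0 : W)).congr hz (hz s hs))

/-- The acceleration of a `C²` curve that runs in a straight line for a while is tangent to it. -/
theorem tangent_acceleration_of_straight {q q' q'' : ℝ → R4} {e : R4} (he : e ≠ 0)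
    (h1 : ∀ s, HasDerivAt q (q' s) s) (h2 : ∀ s, HasDerivAt q' (q'' s) s)
    {J : Set ℝ} (hJ : J.OrdConnected) (hJn : J.Nontrivial) (h0 : (0 : ℝ) ∈ J)
    (hq : ∀ s ∈ J, ∃ t : ℝ, q s = q 0 + t • e) (hq0 : q' 0 ≠ 0) :
    ∃ c : ℝ, q'' 0 = c • q' 0 := by
  obtain ⟨N, hN, hker⟩ := exists_clm_ker_eq_span he
  -- A worldline may begin or end at the given event, so 0 can be an endpoint; derivatives within a
  -- closed interval are still unique.
  obtain ⟨a, b, hab, h0ab, hsub⟩ := exists_Icc_subset_of_nontrivial hJ hJn h0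
  have e1 : ∀ s ∈ Icc a b, N (q s - q 0) = 0 := by
    intro s hs
    obtain ⟨t, ht⟩ := hq s (hsub hs)
    rw [ht, add_sub_cancel_left, map_smul, hN, smul_zero]
  have e2 : ∀ s ∈ Icc a b, N (q' s) = 0 := fun s hs =>
    deriv_eq_zero_of_eqOn_Icc hab e1 hs
      (N.hasFDerivAt.comp_hasDerivAt s ((h1 s).sub_const (q 0)))
  have e3 : N (q'' 0) = 0 :=
    deriv_eq_zero_of_eqOn_Icc hab e2 h0ab (N.hasFDerivAt.comp_hasDerivAt 0 (h2 0))
  obtain ⟨α, hα⟩ := hker _ (e2 0 h0ab)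
  obtain ⟨β, hβ⟩ := hker _ e3
  have hα0 : α ≠ 0 := by
    rintro rfl
    exact hq0 (by simpa using hα)
  exact ⟨β / α, by rw [hα, hβ, smul_smul, div_mul_cancel₀ _ hα0]⟩

/-- A curve with constant velocity `v` is a piece of a straight line in the direction `(v, 1)`. -/
theorem HasConstantVelocity.exists_segment {φ : E ≃ R4} {Γ : Set E} {v : R3}
    (h : HasConstantVelocity φ Γ v) {p : E} (hp : p ∈ Γ) :
    ∃ J : Set ℝ, J.OrdConnected ∧ J.Nontrivial ∧ (0 : ℝ) ∈ J ∧
      φ '' Γ = (fun s : ℝ => φ p + s • ((v, 1) : R4)) '' J := by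
  obtain ⟨I, r, ⟨hI, hIn, -, hΓ⟩, hr⟩ := h
  have hpI : φ p ∈ (fun s => (r s, s)) '' I := hΓ ▸ mem_image_of_mem φ hp
  obtain ⟨s₀, hs₀, hps⟩ := hpI
  have hline : ∀ s ∈ I, r s = r s₀ + (s - s₀) • v := by
    intro s hs
    have hd : ∀ s ∈ I, HasDerivWithinAt (fun s => r s - s • v) 0 I s := by
      intro s hs
      have h := (hr s hs).sub ((hasDerivWithinAt_id s I).smul_const v)
      rw [one_smul, sub_self] at h
      exact h
    have := hI.convex.norm_image_sub_le_of_norm_hasDerivWithin_le hd (C := 0) (by simp) hs₀ hs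
    rw [zero_mul, norm_le_zero_iff, sub_eq_zero] at this
    rw [sub_eq_iff_eq_add] at this
    rw [this]
    module
  refine ⟨(fun s => s + s₀) ⁻¹' I, ?_, ?_, by simpa using hs₀, ?_⟩
  · exact hI.preimage_mono fun a b hab => by simpa using hab
  · exact hIn.preimage (add_right_surjective s₀)
  · rw [hΓ]
    apply Subset.antisymm
    · rintro _ ⟨s, hs, rfl⟩
      refine ⟨s - s₀, by simpa using hs, ?_⟩
      simp only [← hps, hline s hs]
      ext <;> simp
    · rintro _ ⟨s, hs, rfl⟩
      refine ⟨s + s₀, hs, ?_⟩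
      simp only [← hps, hline _ hs]
      ext <;> simp [add_comm]

variable {Φ : Set (E ≃ R4)}

@[simp]
theorem transition_transition (φ φ' : E ≃ R4) (x : R4) :
    transition φ' φ (transition φ φ' x) = x := by
  simp [transition]

theorem fderiv_transition_ne_zero (h_diff : DifferentialStructure Φ) {φ φ' : E ≃ R4} (hφ : φ ∈ Φ)
    (hφ' : φ' ∈ Φ) (x : R4) {w : R4} (hw : w ≠ 0) : fderiv ℝ (transition φ φ') x w ≠ 0 := by
  have h1 := (((h_diff φ' hφ' φ hφ).differentiable (by norm_num)
    (transition φ φ' x)).hasFDerivAt.comp x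
      ((h_diff φ hφ φ' hφ').differentiable (by norm_num) x).hasFDerivAt)
  have h2 : transition φ' φ ∘ transition φ φ' = id := funext (transition_transition φ φ')
  rw [h2] at h1
  have h3 := DFunLike.congr_fun (h1.unique (hasFDerivAt_id x)) w
  intro h0
  apply hw
  simpa [h0] using h3.symm

/-- In the directions of uniform worldlines, the acceleration under a transition function is
tangent. -/
theorem tangent_acceleration_of_physical (h_diff : DifferentialStructure Φ)
    (h_inertiality : Inertiality Φ) {φ φ' : E ≃ R4} (hφ : φ ∈ Φ) (hφ' : φ' ∈ Φ) (x : R4) {v : R3}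
    (hv : v ∈ physicalVelocities Φ φ (φ.symm x)) :
    ∃ c : ℝ, fderiv ℝ (fderiv ℝ (transition φ φ')) x (v, 1) (v, 1) =
      c • fderiv ℝ (transition φ φ') x (v, 1) := by
  obtain ⟨Γ, hΓ, hp, hΓv⟩ := hv
  obtain ⟨-, v', hv'⟩ := (h_inertiality.1 φ hφ φ' hφ' Γ).1 ⟨hΓ, v, hΓv⟩
  obtain ⟨J, hJ, hJn, h0, hseg⟩ := hΓv.exists_segment hp
  obtain ⟨J', -, -, -, hseg'⟩ := hv'.exists_segment hp
  have hf := h_diff φ hφ φ' hφ'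
  have hv1 : ∀ v : R3, ((v, 1) : R4) ≠ 0 := fun v h => by simpa using congrArg Prod.snd h
  have key := tangent_acceleration_of_straight (hv1 v') (hasDerivAt_comp_line hf x (v, 1))
    (hasDerivAt_fderiv_comp_line hf x (v, 1)) hJ hJn h0 ?_ ?_
  · simpa only [zero_smul, add_zero] using key
  · intro s hs
    have hmem : x + s • ((v, 1) : R4) ∈ φ '' Γ := by
      rw [hseg]
      exact ⟨s, hs, by simp⟩
    obtain ⟨q, hq, hqx⟩ := hmem
    have hmem' : φ' q ∈ φ' '' Γ := mem_image_of_mem _ hq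
    rw [hseg'] at hmem'
    obtain ⟨t, -, ht⟩ := hmem'
    refine ⟨t, ?_⟩
    simp only [zero_smul, add_zero]
    rw [← hqx]
    simp only [transition, Equiv.symm_apply_apply]
    exact ht.symm
  · exact fderiv_transition_ne_zero h_diff hφ hφ' _ (hv1 v)

/-- Composing D²f with the inverse of Df turns tangency into B(w,w) ∥ w. This is known for the open
set of physical directions, extends to all w by `quadratic_parallel`, and is carried back by Df. -/
theorem tangent_acceleration_transition (h_diff : DifferentialStructure Φ)
    (h_velocities : PhysicalVelocities Φ) (h_inertiality : Inertiality Φ) {φ φ' : E ≃ R4}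
    (hφ : φ ∈ Φ) (hφ' : φ' ∈ Φ) (x w : R4) :
    ∃ c : ℝ, fderiv ℝ (fderiv ℝ (transition φ φ')) x w w = c • fderiv ℝ (transition φ φ') x w := by
  set f := transition φ φ' with hf
  set g := transition φ' φ with hg
  have hdf : Differentiable ℝ f := (h_diff φ hφ φ' hφ').differentiable (by norm_num)
  have hdg : Differentiable ℝ g := (h_diff φ' hφ' φ hφ).differentiable (by norm_num)
  have hgf : ∀ w, fderiv ℝ g (f x) (fderiv ℝ f x w) = w := by
    have h1 := (hdg (f x)).hasFDerivAt.comp x (hdf x).hasFDerivAt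
    have h2 : g ∘ f = id := funext (transition_transition φ φ')
    rw [h2] at h1
    exact fun w => DFunLike.congr_fun (h1.unique (hasFDerivAt_id x)) w
  have hfg : ∀ w, fderiv ℝ f x (fderiv ℝ g (f x) w) = w := by
    have h0 : x = g (f x) := (transition_transition φ φ' x).symm
    have h1 := (h0 ▸ (hdf x).hasFDerivAt : HasFDerivAt f (fderiv ℝ f x) (g (f x))).comp (f x)
      (hdg (f x)).hasFDerivAt
    have h2 : f ∘ g = id := funext (transition_transition φ' φ)
    rw [h2] at h1
    exact fun w => DFunLike.congr_fun (h1.unique (hasFDerivAt_id (f x))) w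
  set B := ((ContinuousLinearMap.compL ℝ R4 R4 R4) (fderiv ℝ g (f x))).comp
      (fderiv ℝ (fderiv ℝ f) x) with hB
  have hphys : ∀ᶠ v : R3 in 𝓝 0, ∃ c : ℝ, B (v, 1) (v, 1) = c • ((v, 1) : R4) := by
    filter_upwards [(h_velocities φ hφ (φ.symm x)).2] with v hv
    obtain ⟨c, hc⟩ := tangent_acceleration_of_physical h_diff h_inertiality hφ hφ' x hv
    refine ⟨c, ?_⟩
    simp only [hB, ContinuousLinearMap.comp_apply, ContinuousLinearMap.compL_apply]
    rw [hf] at *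
    rw [hc, map_smul, hgf]
  obtain ⟨c, hc⟩ := quadratic_parallel B hphys w
  refine ⟨c, ?_⟩
  have := congrArg (fderiv ℝ f x) hc
  simpa [hB, hfg] using this

/-- The transition functions between inertially equivalent coordinate systems are affine. -/
theorem transition_affine (h_diff : DifferentialStructure Φ)
    (h_velocities : PhysicalVelocities Φ) (h_inertiality : Inertiality Φ) {φ φ' : E ≃ R4}
    (hφ : φ ∈ Φ) (hφ' : φ' ∈ Φ) :
    ∃ A : R4 →L[ℝ] R4, ∀ x, transition φ φ' x = transition φ φ' 0 + A x :=
  affine_of_tangent_acceleration (by simp) (h_diff φ hφ φ' hφ')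
    (h_diff φ' hφ' φ hφ) (transition_transition φ φ') (transition_transition φ' φ)
    (tangent_acceleration_transition h_diff h_velocities h_inertiality hφ hφ')
    (tangent_acceleration_transition h_diff h_velocities h_inertiality hφ' hφ)

end Worldlines

/-! ### The linear part of the structure group -/

/-- The properties of a structure group on which the derivation of the special transformations
rests: it consists of affine maps and contains the translations, linear maps in it have positive
spatial determinant and preserve the time direction, those with velocity `0` are rotations, and
their velocities form an open set. -/
structure KinematicGroup (G : Subgroup (Equiv.Perm R4)) : Prop where
  translation_mem : ∀ b : R4, Equiv.addRight b ∈ G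
  affine : ∀ g ∈ G, ∃ (L : R4 →L[ℝ] R4) (b : R4), ∀ x, g x = L x + b
  det_pos : ∀ L, InGroup G L →
    0 < ((ContinuousLinearMap.fst ℝ R3 ℝ).comp (L.comp (ContinuousLinearMap.inl ℝ R3 ℝ))).det
  time_pos : ∀ L, InGroup G L → 0 < (L (0, 1)).2
  eq_rotation : ∀ L, InGroup G L → (L (0, 1)).1 = 0 → ∃ S ∈ SO3, L = spatialRotation S
  isOpen_velocities : IsOpen {V : R3 | ∃ L, InGroup G L ∧ (L (V, 1)).1 = 0}

section InGroup

variable {G : Subgroup (Equiv.Perm R4)} {L M : R4 →L[ℝ] R4}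

theorem InGroup.comp (hL : InGroup G L) (hM : InGroup G M) : InGroup G (L.comp M) := by
  obtain ⟨g, hg, hgL⟩ := hL
  obtain ⟨h, hh, hhM⟩ := hM
  exact ⟨g * h, G.mul_mem hg hh, by rw [Equiv.Perm.coe_mul, hgL, hhM]; rfl⟩

theorem InGroup.injective (hL : InGroup G L) : Function.Injective L := by
  obtain ⟨g, hg, hgL⟩ := hL
  exact hgL ▸ g.injective

theorem inGroup_id : InGroup G (ContinuousLinearMap.id ℝ R4) := ⟨1, G.one_mem, rfl⟩

theorem exists_linear_inverse_of_affine
    (haff : ∀ g ∈ G, ∃ (L : R4 →L[ℝ] R4) (b : R4), ∀ x, g x = L x + b) (hL : InGroup G L) :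
    ∃ M, InGroup G M ∧ (∀ x, M (L x) = x) ∧ ∀ x, L (M x) = x := by
  obtain ⟨g, hg, hgL⟩ := hL
  obtain ⟨M, b, hM⟩ := haff _ (G.inv_mem hg)
  have hb : b = 0 := by
    have h0 : g⁻¹ 0 = 0 := by
      rw [Equiv.Perm.inv_eq_iff_eq, hgL, map_zero]
    simpa [h0] using (hM 0).symm
  subst hb
  simp only [add_zero] at hM
  refine ⟨M, ⟨g⁻¹, G.inv_mem hg, funext hM⟩, fun x => ?_, fun x => ?_⟩
  · simp [← hgL, ← hM]
  · simp [← hgL, ← hM]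

theorem KinematicGroup.exists_inverse (hK : KinematicGroup G) (hL : InGroup G L) :
    ∃ M, InGroup G M ∧ (∀ x, M (L x) = x) ∧ ∀ x, L (M x) = x :=
  exists_linear_inverse_of_affine hK.affine hL

theorem InGroup.of_affine (htrans : ∀ b : R4, Equiv.addRight b ∈ G) {g : Equiv.Perm R4}
    (hg : g ∈ G) {b : R4} (h : ∀ x, g x = L x + b) : InGroup G L :=
  ⟨Equiv.addRight (-b) * g, G.mul_mem (htrans _) hg, by
    ext1 x
    simp [h]⟩

theorem KinematicGroup.mem_of_affine (hK : KinematicGroup G) (hL : InGroup G L)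
    {g : Equiv.Perm R4} {b : R4} (h : ∀ x, g x = L x + b) : g ∈ G := by
  obtain ⟨k, hk, hkL⟩ := hL
  have : g = Equiv.addRight b * k := by
    ext1 x
    simp [h, ← hkL]
  rw [this]
  exact G.mul_mem (hK.translation_mem b) hk

end InGroup

/-! ### From the axioms to the linear structure group -/

section StructureGroup

variable {E : Type*} {Φ : Set (E ≃ R4)} {G : Subgroup (Equiv.Perm R4)}

theorem IsStructureGroup.trans_mem_iff (hG : IsStructureGroup Φ G) {φ : E ≃ R4} (hφ : φ ∈ Φ)
    (g : Equiv.Perm R4) : φ.trans g ∈ Φ ↔ g ∈ G := by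
  obtain ⟨φ₀, -, hΦ⟩ := hG
  rw [hΦ] at hφ ⊢
  obtain ⟨h, hh, rfl⟩ := hφ
  constructor
  · rintro ⟨k, hk, hkg⟩
    have : g * h = k := by
      ext1 x
      simpa using DFunLike.congr_fun hkg (φ₀.symm x)
    rw [← G.mul_mem_cancel_right hh, this]
    exact hk
  · intro hg
    exact ⟨g * h, G.mul_mem hg hh, rfl⟩

theorem IsStructureGroup.exists_trans (hG : IsStructureGroup Φ G) {φ φ' : E ≃ R4} (hφ : φ ∈ Φ)
    (hφ' : φ' ∈ Φ) : ∃ g ∈ G, φ' = φ.trans g := by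
  have h : φ' = φ.trans (φ.symm.trans φ') := by ext1; simp
  exact ⟨φ.symm.trans φ', (hG.trans_mem_iff hφ _).1 (h ▸ hφ'), h⟩

theorem restPoint_eq_of_linear {φ φ' : E ≃ R4} {M : R4 →L[ℝ] R4}
    (h : ∀ x, φ'.symm x = φ.symm (M x)) (h1 : (M (0, 1)).1 = 0) (h2 : (M (0, 1)).2 ≠ 0) (r : R3) :
    restPoint φ' r = restPoint φ (M (r, 0)).1 := by
  have key : ∀ s : ℝ, M (r, s) = ((M (r, 0)).1, (M (r, 0)).2 + s * (M (0, 1)).2) := by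
    intro s
    have : ((r, s) : R4) = (r, 0) + s • ((0, 1) : R4) := by simp
    rw [this, map_add, map_smul]
    refine Prod.ext ?_ ?_ <;> simp [h1]
  apply Subset.antisymm
  · rintro _ ⟨s, rfl⟩
    exact ⟨(M (r, 0)).2 + s * (M (0, 1)).2, by dsimp only; rw [h, key s]⟩
  · rintro _ ⟨t, rfl⟩
    refine ⟨(t - (M (r, 0)).2) / (M (0, 1)).2, ?_⟩
    dsimp only
    rw [h, key, div_mul_cancel₀ _ h2, add_sub_cancel]

/-- The inverse of an injective linear map whose last column is `(0, α)`. -/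
theorem inverse_apply_time {L M : R4 →L[ℝ] R4} (hML : ∀ x, M (L x) = x)
    (h1 : (L (0, 1)).1 = 0) :
    (L (0, 1)).2 ≠ 0 ∧ (M (0, 1)).1 = 0 ∧ (M (0, 1)).2 ≠ 0 := by
  have hL : L (0, 1) = (L (0, 1)).2 • ((0, 1) : R4) := by ext <;> simp [h1]
  have h3 : (L (0, 1)).2 • M (0, 1) = (0, 1) := by rw [← map_smul, ← hL, hML]
  have e2 : (L (0, 1)).2 * (M (0, 1)).2 = 1 := by simpa using congrArg Prod.snd h3
  have e1 : (L (0, 1)).2 • (M (0, 1)).1 = 0 := by simpa using congrArg Prod.fst h3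
  have h0 : (L (0, 1)).2 ≠ 0 := left_ne_zero_of_mul_eq_one e2
  exact ⟨h0, (smul_eq_zero.1 e1).resolve_left h0, right_ne_zero_of_mul_eq_one e2⟩

/-- The events (0,0) and (0,1) of the new system lie on one point at rest in it, so in the old
system they differ by a multiple of (V,1), which L must send to the time axis. With
`hasVelocity_of_linear` this translates velocities into a condition on matrices. -/
theorem velocity_mem_of_hasVelocity
    (haff : ∀ g ∈ G, ∃ (L : R4 →L[ℝ] R4) (b : R4), ∀ x, g x = L x + b)
    (htrans : ∀ b : R4, Equiv.addRight b ∈ G) {φ : E ≃ R4} {g : Equiv.Perm R4}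
    (hg : g ∈ G) {V : R3} (h : HasVelocity φ (φ.trans g) V) :
    ∃ L, InGroup G L ∧ (L (V, 1)).1 = 0 := by
  obtain ⟨L, b, hL⟩ := haff g hg
  have hLG := InGroup.of_affine htrans hg hL
  refine ⟨L, hLG, ?_⟩
  obtain ⟨J, -, -, -, hJ⟩ := (h 0).exists_segment (mem_range_self (0 : ℝ))
  have hmem : φ ((φ.trans g).symm (0, 1)) ∈ φ '' restPoint (φ.trans g) 0 :=
    mem_image_of_mem φ (mem_range_self (1 : ℝ))
  rw [hJ] at hmem
  obtain ⟨s, -, hs⟩ := hmem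
  simp only [Equiv.symm_trans_apply, Equiv.apply_symm_apply] at hs
  have h1 : g (g.symm (0, 0) + s • ((V, 1) : R4)) = (0, 1) := by rw [hs]; simp
  have h0 : g (g.symm (0, 0)) = (0, 0) := by simp
  rw [hL] at h1 h0
  rw [map_add, map_smul, add_right_comm, h0] at h1
  have e1 : s • (L (V, 1)).1 = 0 := by simpa using congrArg Prod.fst h1
  have e2 : s * (L (V, 1)).2 = 1 := by simpa using congrArg Prod.snd h1
  exact (smul_eq_zero.1 e1).resolve_left (left_ne_zero_of_mul_eq_one e2)

theorem hasVelocity_of_linear {φ : E ≃ R4} {g : Equiv.Perm R4} {L M : R4 →L[ℝ] R4}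
    (hgL : (g : R4 → R4) = L) (hML : ∀ x, M (L x) = x) {V : R3} (hV : (L (V, 1)).1 = 0) :
    HasVelocity φ (φ.trans g) V := by
  intro r
  have hgM : ∀ x, g.symm x = M x := by
    intro x
    rw [← hML (g.symm x), ← hgL, Equiv.apply_symm_apply]
  set β := (L (V, 1)).2 with hβ
  have hLV : L (V, 1) = β • ((0, 1) : R4) := by ext <;> simp [hV, hβ]
  have h3 : β • M (0, 1) = (V, 1) := by rw [← map_smul, ← hLV, hML]
  have hβ0 : β ≠ 0 := left_ne_zero_of_mul_eq_one (b := (M (0, 1)).2) (by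
    simpa using congrArg Prod.snd h3)
  have hM1 : ∀ s : ℝ, M (r, s) = M (r, 0) + (s / β) • ((V, 1) : R4) := by
    intro s
    have : ((r, s) : R4) = (r, 0) + s • ((0, 1) : R4) := by simp
    rw [this, map_add, map_smul, ← h3, smul_smul, div_mul_cancel₀ _ hβ0]
  set y := M (r, 0) with hy
  refine ⟨univ, fun s => y.1 + (s - y.2) • V, ⟨ordConnected_univ, nontrivial_univ, ?_, ?_⟩, ?_⟩
  · apply Differentiable.differentiableOn
    fun_prop
  · apply Subset.antisymm
    · rintro _ ⟨_, ⟨s, rfl⟩, rfl⟩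
      refine ⟨y.2 + s / β, mem_univ _, ?_⟩
      simp only [Equiv.symm_trans_apply, Equiv.apply_symm_apply, hgM, hM1]
      ext <;> simp
    · rintro _ ⟨t, -, rfl⟩
      refine ⟨_, ⟨(t - y.2) * β, rfl⟩, ?_⟩
      simp only [Equiv.symm_trans_apply, Equiv.apply_symm_apply, hgM, hM1]
      rw [mul_div_cancel_right₀ _ hβ0]
      ext <;> simp
  · intro s _
    have : HasDerivAt (fun s : ℝ => y.1 + (s - y.2) • V) ((1 : ℝ) • V) s :=
      (((hasDerivAt_id s).sub_const y.2).smul_const V).const_add y.1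
    rw [one_smul] at this
    exact this.hasDerivWithinAt

/-- Everything is read off from the system φ supplied by abundance: the transition function from φ
to g ∘ φ is g itself. Time direction comes from comparing two events on a point at rest, rotations
from mutual rest, and openness from the fact that abundance makes the set of velocities an interior.
-/
theorem kinematicGroup_of_axioms
    (h_diff : DifferentialStructure Φ) (h_causality : Causality Φ) (h_time : TimeOrientation Φ)
    (h_space : SpatialOrientation Φ) (h_rest : MutualRest Φ) (hG : IsStructureGroup Φ G)
    (h_velocities : PhysicalVelocities Φ) (h_inertiality : Inertiality Φ)
    (h_abundance : Abundance Φ) : KinematicGroup G := by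
  obtain ⟨φ, hφ, p, hab⟩ := h_abundance
  have hmem := hG.trans_mem_iff hφ
  have htrans : ∀ b : R4, Equiv.addRight b ∈ G := fun b =>
    (hmem _).1 (h_inertiality.2 φ hφ b)
  have htr : ∀ g : Equiv.Perm R4, transition φ (φ.trans g) = g := fun g => by
    ext1 x; simp [transition]
  have haff : ∀ g ∈ G, ∃ (L : R4 →L[ℝ] R4) (b : R4), ∀ x, g x = L x + b := by
    intro g hg
    obtain ⟨L, hL⟩ := transition_affine h_diff h_velocities h_inertiality hφ ((hmem g).2 hg)
    refine ⟨L, g 0, fun x => ?_⟩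
    rw [htr] at hL
    rw [hL, add_comm]
  refine ⟨htrans, haff, ?_, ?_, ?_, ?_⟩
  · rintro L ⟨g, hg, hgL⟩
    have := h_space φ hφ _ ((hmem g).2 hg) 0
    rwa [spatialJacobian, htr, hgL, ContinuousLinearMap.fderiv] at this
  · rintro L ⟨g, hg, hgL⟩
    have := (h_time φ hφ _ ((hmem g).2 hg) _ (h_causality φ hφ 0) (φ.symm (0, 0)) ⟨0, rfl⟩
      (φ.symm (0, 1)) ⟨1, rfl⟩).1 (by simp)
    simpa [hgL, show ((0, 0) : R4) = 0 from rfl] using this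
  · intro L hL h0
    obtain ⟨M, hM, hML, hLM⟩ := exists_linear_inverse_of_affine haff hL
    obtain ⟨g, hg, hgL⟩ := hL
    obtain ⟨hL2, hM1, hM2⟩ := inverse_apply_time hML h0
    have hgM : ∀ x, g.symm x = M x := by
      intro x
      rw [← hML (g.symm x), ← hgL, Equiv.apply_symm_apply]
    obtain ⟨S, hS, b, hSb⟩ := h_rest φ hφ (φ.trans g) ((hmem g).2 hg)
      (fun r => ⟨_, restPoint_eq_of_linear (M := M) (by simp [hgM]) hM1 hM2 r⟩)
      (fun r => ⟨_, restPoint_eq_of_linear (M := L) (by simp [← hgL]) h0 hL2 r⟩)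
    have hLS : ∀ x, L x = spatialRotation S x + b := by
      intro x
      simpa [hgL] using hSb (φ.symm x)
    have hb : b = 0 := by simpa using (hLS 0).symm
    refine ⟨S, hS, ?_⟩
    refine ContinuousLinearMap.ext fun x => ?_
    simpa [hb] using hLS x
  · convert isOpen_interior (s := physicalVelocities Φ φ p) using 1
    ext V
    constructor
    · rintro ⟨L, hL, hV⟩
      obtain ⟨M, hM, hML, hLM⟩ := exists_linear_inverse_of_affine haff hL
      obtain ⟨g, hg, hgL⟩ := hL
      exact hab.2 _ ((hmem g).2 hg) V (hasVelocity_of_linear hgL hML hV)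
    · intro hV
      obtain ⟨φ', hφ', h⟩ := hab.1 V hV
      obtain ⟨g, hg, rfl⟩ := hG.exists_trans hφ hφ'
      exact velocity_mem_of_hasVelocity haff htrans hg h

end StructureGroup

/-! ### Matrices acting on `ℝ³` -/

theorem act_one_apply (x : R3) : act 1 x = x := by simp [act]

theorem act_mul_apply (A B : Matrix (Fin 3) (Fin 3) ℝ) (x : R3) :
    act (A * B) x = act A (act B x) := by simp [act]

theorem act_vecMulVec_apply (u v x : R3) : act (Matrix.vecMulVec u v) x = ⟪v, x⟫ • u := by
  ext i
  rw [Matrix.ofLp_toEuclideanCLM, Matrix.vecMulVec_mulVec]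
  simp [PiLp.inner_apply, dotProduct, mul_comm]

theorem inner_act_left (A : Matrix (Fin 3) (Fin 3) ℝ) (x y : R3) :
    ⟪act A x, y⟫ = ⟪x, act A.transpose y⟫ := by
  rw [Matrix.inner_toEuclideanCLM, real_inner_comm, Matrix.inner_toEuclideanCLM,
    Matrix.dotProduct_mulVec, ← Matrix.mulVec_transpose, dotProduct_comm]

theorem dotProduct_self_of_norm_eq_one {u : R3} (hu : ‖u‖ = 1) : dotProduct u.ofLp u.ofLp = 1 := by
  have := real_inner_self_eq_norm_sq u
  rw [hu, PiLp.inner_apply] at this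
  simpa only [dotProduct, RCLike.inner_apply, conj_trivial, one_pow] using this

/-- The eigenvalues are p along u and l, twice, on the orthogonal plane. -/
theorem det_smul_one_add_vecMulVec {u : R3} (hu : ‖u‖ = 1) {l : ℝ} (hl : l ≠ 0) (p : ℝ) :
    (l • (1 : Matrix (Fin 3) (Fin 3) ℝ) + (p - l) • Matrix.vecMulVec u u).det = l ^ 2 * p := by
  have h1 : l • (1 : Matrix (Fin 3) (Fin 3) ℝ) + (p - l) • Matrix.vecMulVec u u =
      l • (1 + Matrix.replicateCol Unit (((p - l) / l) • u.ofLp) *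
        Matrix.replicateRow Unit u.ofLp) := by
    rw [← Matrix.vecMulVec_eq, Matrix.smul_vecMulVec, smul_add, smul_smul, mul_div_cancel₀ _ hl]
  rw [h1, Matrix.det_smul, Matrix.det_one_add_replicateCol_mul_replicateRow, dotProduct_smul,
    dotProduct_self_of_norm_eq_one hu]
  simp
  field_simp
  ring

theorem det_act (A : Matrix (Fin 3) (Fin 3) ℝ) : (act A).det = A.det := by
  have : (act A : R3 →ₗ[ℝ] R3) = Matrix.toLin (EuclideanSpace.basisFun (Fin 3) ℝ).toBasis
      (EuclideanSpace.basisFun (Fin 3) ℝ).toBasis A := by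
    rw [act, Matrix.coe_toEuclideanCLM_eq_toEuclideanLin]
    exact DFunLike.congr_fun (Matrix.toLpLin_eq_toLin 2 2) A
  rw [ContinuousLinearMap.det, this, LinearMap.det_toLin]

theorem mem_SO3_iff {S : Matrix (Fin 3) (Fin 3) ℝ} :
    S ∈ SO3 ↔ S * S.transpose = 1 ∧ S.det = 1 := by
  rw [Matrix.mem_specialOrthogonalGroup_iff, Matrix.mem_orthogonalGroup_iff]

theorem act_transpose_act {S : Matrix (Fin 3) (Fin 3) ℝ} (hS : S ∈ SO3) (x : R3) :
    act S.transpose (act S x) = x := by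
  rw [← act_mul_apply, mul_eq_one_comm.1 (mem_SO3_iff.1 hS).1, act_one_apply]

theorem norm_act {S : Matrix (Fin 3) (Fin 3) ℝ} (hS : S ∈ SO3) (x : R3) : ‖act S x‖ = ‖x‖ := by
  have h : ‖act S x‖ ^ 2 = ‖x‖ ^ 2 := by
    rw [← real_inner_self_eq_norm_sq, inner_act_left, act_transpose_act hS,
      real_inner_self_eq_norm_sq]
  exact (pow_left_inj₀ (norm_nonneg _) (norm_nonneg _) two_ne_zero).1 h

theorem exists_unit_orthogonal (u : R3) : ∃ n : R3, ‖n‖ = 1 ∧ ⟪u, n⟫ = 0 := by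
  obtain ⟨m, hm, hm0⟩ : ∃ m : R3, ⟪u, m⟫ = 0 ∧ m ≠ 0 := by
    have hpos : 0 < Module.finrank ℝ (LinearMap.ker (innerSL ℝ u : R3 →ₗ[ℝ] ℝ)) := by
      have h1 := LinearMap.finrank_range_add_finrank_ker (innerSL ℝ u : R3 →ₗ[ℝ] ℝ)
      have h2 := Submodule.finrank_le (LinearMap.range (innerSL ℝ u : R3 →ₗ[ℝ] ℝ))
      simp only [finrank_euclideanSpace, Fintype.card_fin, Module.finrank_self] at h1 h2
      omega
    have := Module.nontrivial_of_finrank_pos (R := ℝ) hpos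
    obtain ⟨⟨m, hm⟩, hm0⟩ := exists_ne (0 : LinearMap.ker (innerSL ℝ u : R3 →ₗ[ℝ] ℝ))
    exact ⟨m, by simpa using hm, fun h => hm0 (by ext1; exact h)⟩
  exact ⟨‖m‖⁻¹ • m, norm_smul_inv_norm (𝕜 := ℝ) hm0, by rw [inner_smul_right, hm, mul_zero]⟩

/-- The half-turn about the axis spanned by the unit vector `n`. -/
def halfTurn (n : R3) : Matrix (Fin 3) (Fin 3) ℝ :=
  (-1 : ℝ) • (1 : Matrix (Fin 3) (Fin 3) ℝ) + ((1 : ℝ) - (-1)) • Matrix.vecMulVec n n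

theorem act_halfTurn (n x : R3) : act (halfTurn n) x = (2 * ⟪n, x⟫) • n - x := by
  have : act (halfTurn n) x = (-1 : ℝ) • act 1 x + ((1 : ℝ) - (-1)) • act (Matrix.vecMulVec n n) x := by
    simp only [halfTurn, act, map_add, map_smul, add_apply, smul_apply]
  rw [this, act_one_apply, act_vecMulVec_apply]
  module

theorem transpose_halfTurn (n : R3) : (halfTurn n).transpose = halfTurn n := by
  simp [halfTurn, Matrix.transpose_vecMulVec]

theorem halfTurn_mem {n : R3} (hn : ‖n‖ = 1) : halfTurn n ∈ SO3 := by
  rw [mem_SO3_iff, transpose_halfTurn]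
  constructor
  · apply (Matrix.toEuclideanCLM (n := Fin 3) (𝕜 := ℝ)).injective
    refine ContinuousLinearMap.ext fun x => ?_
    change act (halfTurn n * halfTurn n) x = act 1 x
    rw [act_mul_apply, act_one_apply, act_halfTurn, act_halfTurn, inner_sub_right,
      inner_smul_right, real_inner_self_eq_norm_sq, hn]
    module
  · rw [halfTurn, det_smul_one_add_vecMulVec hn (by norm_num)]
    norm_num

/-- The axis is the bisector of u and u', or any axis orthogonal to u if u' = -u. Half-turns suffice
for isotropy and are their own inverses, which keeps conjugation simple. -/
theorem exists_halfTurn_eq {u u' : R3} (hu : ‖u‖ = 1) (hu' : ‖u'‖ = 1) :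
    ∃ n : R3, ‖n‖ = 1 ∧ act (halfTurn n) u = u' := by
  rcases eq_or_ne (u + u') 0 with h | h
  · obtain ⟨n, hn, hun⟩ := exists_unit_orthogonal u
    refine ⟨n, hn, ?_⟩
    rw [act_halfTurn, real_inner_comm, hun, eq_neg_of_add_eq_zero_right h]
    simp
  · refine ⟨‖u + u'‖⁻¹ • (u + u'), norm_smul_inv_norm (𝕜 := ℝ) h, ?_⟩
    have h1 : ‖u + u'‖ ^ 2 = 2 * ⟪u + u', u⟫ := by
      rw [norm_add_sq_real, inner_add_left, real_inner_self_eq_norm_sq, hu, hu',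
        real_inner_comm u u']
      ring
    have h2 : ‖u + u'‖ ≠ 0 := norm_ne_zero_iff.2 h
    rw [act_halfTurn, inner_smul_left, smul_smul]
    have h3 : 2 * (starRingEnd ℝ ‖u + u'‖⁻¹ * ⟪u + u', u⟫) * ‖u + u'‖⁻¹ = 1 := by
      simp only [conj_trivial]
      field_simp
      rw [h1]
    rw [h3]
    simp

/-! ### The determinant of a linear map in block form -/

theorem det_blockMap (A : Matrix (Fin 3) (Fin 3) ℝ) (w k : R3) (α : ℝ) :
    (blockMap A w k α).det = (Matrix.fromBlocks A (Matrix.replicateCol Unit w.ofLp)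
      (Matrix.replicateRow Unit k.ofLp) (Matrix.of fun _ _ => α)).det := by
  set b := (EuclideanSpace.basisFun (Fin 3) ℝ).toBasis.prod (Module.Basis.singleton Unit ℝ) with hb
  rw [ContinuousLinearMap.det, ← LinearMap.det_toMatrix b]
  congr 1
  ext i j
  rw [LinearMap.toMatrix_apply]
  rcases i with i | i <;> rcases j with j | j <;>
    simp [hb, blockMap_apply, Matrix.mulVec_single, EuclideanSpace.inner_single_right]

theorem det_blockMap_velocity (A : Matrix (Fin 3) (Fin 3) ℝ) (V k : R3) (α : ℝ) :
    (blockMap A (-(act A V)) k α).det = A.det * (α + ⟪k, V⟫) := by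
  -- Splitting off the shear r ↦ r - t V leaves a block triangular map.
  have h : blockMap A (-(act A V)) k α =
      (blockMap A 0 k (α + ⟪k, V⟫)).comp (blockMap 1 (-V) 0 1) := by
    refine ContinuousLinearMap.ext fun x => ?_
    obtain ⟨r, t⟩ := x
    rw [ContinuousLinearMap.comp_apply, blockMap_apply, blockMap_apply, blockMap_apply]
    simp only [act_one_apply, inner_add_right, inner_smul_right, inner_neg_right, inner_zero_left,
      map_add, map_smul, map_neg, smul_zero, add_zero]
    refine Prod.ext rfl ?_
    simp only
    ring
  have hmul : ∀ L M : R4 →L[ℝ] R4, (L.comp M).det = L.det * M.det := fun L M =>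
    LinearMap.det_comp (L : R4 →ₗ[ℝ] R4) M
  have hz1 : (Matrix.replicateCol Unit (0 : R3).ofLp : Matrix (Fin 3) Unit ℝ) = 0 := by ext; simp
  have hz2 : (Matrix.replicateRow Unit (0 : R3).ofLp : Matrix Unit (Fin 3) ℝ) = 0 := by ext; simp
  rw [h, hmul, det_blockMap, det_blockMap, hz1, hz2, Matrix.det_fromBlocks_zero₁₂,
    Matrix.det_fromBlocks_zero₂₁]
  simp

/-! ### Planar maps -/

theorem spatialRotation_apply (S : Matrix (Fin 3) (Fin 3) ℝ) (x : R4) :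
    spatialRotation S x = (act S x.1, x.2) := by
  obtain ⟨r, t⟩ := x
  simp [spatialRotation, blockMap_apply]

/-- The linear map of `ℝ⁴` that acts on the plane spanned by `u` and the time axis by the matrix
with rows `(p, q)` and `(r, s)`, and on the orthogonal complement of this plane by the factor `l`. -/
def planar (u : R3) (l p q r s : ℝ) : R4 →L[ℝ] R4 :=
  blockMap (l • 1 + (p - l) • Matrix.vecMulVec u u) (q • u) (r • u) s

theorem planar_apply (u : R3) (l p q r s : ℝ) (x : R4) :
    planar u l p q r s x =
      (l • x.1 + ((p - l) * ⟪u, x.1⟫ + q * x.2) • u, r * ⟪u, x.1⟫ + s * x.2) := by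
  obtain ⟨x, t⟩ := x
  have : act (l • 1 + (p - l) • Matrix.vecMulVec u u) x =
      l • act 1 x + (p - l) • act (Matrix.vecMulVec u u) x := by
    simp only [act, map_add, map_smul, add_apply, smul_apply]
  rw [planar, blockMap_apply, this, act_one_apply, act_vecMulVec_apply, inner_smul_left]
  refine Prod.ext ?_ rfl
  simp only
  module

/-- In planar form, composing special transformations is multiplication of 2×2 matrices and of the
factors l. -/
theorem isSpecial_iff {u : R3} {v : ℝ} {L : R4 →L[ℝ] R4} :
    IsSpecial u v L ↔ ∃ a b α lam : ℝ, 0 < a ∧ 0 < α ∧ 0 < lam ∧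
      L = planar u lam (lam * a) (-(lam * a * v)) (lam * b * v) (lam * α) := by
  unfold IsSpecial
  have key : ∀ a b α lam : ℝ,
      lam • blockMap (1 + (a - 1) • Matrix.vecMulVec u u) (-(a • v • u)) (b • v • u) α =
        planar u lam (lam * a) (-(lam * a * v)) (lam * b * v) (lam * α) := by
    intro a b α lam
    refine ContinuousLinearMap.ext fun x => ?_
    obtain ⟨x, t⟩ := x
    have : act (1 + (a - 1) • Matrix.vecMulVec u u) x =
        act 1 x + (a - 1) • act (Matrix.vecMulVec u u) x := by
      simp only [act, map_add, map_smul, add_apply, smul_apply]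
    rw [planar_apply, smul_apply, blockMap_apply, this, act_one_apply, act_vecMulVec_apply,
      inner_smul_left, inner_smul_left]
    refine Prod.ext ?_ ?_
    · simp only [Prod.smul_fst]
      module
    · simp only [Prod.smul_snd, conj_trivial, smul_eq_mul]
      ring
  simp only [key]

section Planar

variable {u : R3}

theorem inner_self_of_unit (hu : ‖u‖ = 1) : ⟪u, u⟫ = (1 : ℝ) := by
  rw [real_inner_self_eq_norm_sq, hu, one_pow]

theorem planar_comp (hu : ‖u‖ = 1) (l p q r s l' p' q' r' s' : ℝ) :
    (planar u l p q r s).comp (planar u l' p' q' r' s') =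
      planar u (l * l') (p * p' + q * r') (p * q' + q * s') (r * p' + s * r')
        (r * q' + s * s') := by
  refine ContinuousLinearMap.ext fun x => ?_
  simp only [ContinuousLinearMap.comp_apply, planar_apply, inner_add_right, inner_smul_right,
    inner_self_of_unit hu]
  refine Prod.ext ?_ ?_
  · simp only
    module
  · simp only
    ring

theorem planar_one (u : R3) : planar u 1 1 0 0 1 = ContinuousLinearMap.id ℝ R4 := by
  refine ContinuousLinearMap.ext fun x => ?_
  simp [planar_apply]

theorem planar_apply_time (u : R3) (l p q r s : ℝ) : planar u l p q r s (0, 1) = (q • u, s) := by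
  simp [planar_apply]

theorem planar_apply_plane (hu : ‖u‖ = 1) (l p q r s a t : ℝ) :
    planar u l p q r s (a • u, t) = ((p * a + q * t) • u, r * a + s * t) := by
  simp only [planar_apply, inner_smul_right, inner_self_of_unit hu, mul_one]
  refine Prod.ext ?_ rfl
  simp only
  module

theorem planar_inj (hu : ‖u‖ = 1) {l p q r s l' p' q' r' s' : ℝ}
    (h : planar u l p q r s = planar u l' p' q' r' s') :
    l = l' ∧ p = p' ∧ q = q' ∧ r = r' ∧ s = s' := by
  have hu0 : u ≠ 0 := by rintro rfl; simp at hu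
  have inj := smul_left_injective ℝ hu0
  have h1 := DFunLike.congr_fun h ((0 : ℝ) • u, 1)
  have h2 := DFunLike.congr_fun h ((1 : ℝ) • u, 0)
  rw [planar_apply_plane hu, planar_apply_plane hu, Prod.mk.injEq] at h1 h2
  obtain ⟨n, hn, hun⟩ := exists_unit_orthogonal u
  have hn0 : n ≠ 0 := by rintro rfl; simp at hn
  have h3 := congrArg Prod.fst (DFunLike.congr_fun h (n, 0))
  simp only [planar_apply, hun, mul_zero, add_zero, zero_smul] at h3
  have e1 := inj h1.1
  have e2 := inj h2.1
  refine ⟨smul_left_injective ℝ hn0 h3, ?_, ?_, ?_, ?_⟩ <;> linarith [h1.2, h2.2]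

theorem conj_planar {n : R3} (hn : ‖n‖ = 1) (u : R3) (l p q r s : ℝ) :
    ((spatialRotation (halfTurn n)).comp (planar u l p q r s)).comp
      (spatialRotation (halfTurn n)) = planar (act (halfTurn n) u) l p q r s := by
  refine ContinuousLinearMap.ext fun x => ?_
  have hS := halfTurn_mem hn
  simp only [ContinuousLinearMap.comp_apply, planar_apply, spatialRotation_apply]
  have h2 : act (halfTurn n) (act (halfTurn n) x.1) = x.1 := by
    have := act_transpose_act hS x.1
    rwa [transpose_halfTurn] at this
  rw [inner_act_left, transpose_halfTurn, map_add, map_smul, map_smul, h2]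

theorem planar_neg (u : R3) (l p q r s : ℝ) :
    planar (-u) l p q r s = planar u l p (-q) (-r) s := by
  refine ContinuousLinearMap.ext fun x => ?_
  simp only [planar_apply, inner_neg_left]
  refine Prod.ext ?_ ?_
  · simp only
    module
  · simp

end Planar

/-! ### Planar maps in the structure group -/

section Kinematic

variable {G : Subgroup (Equiv.Perm R4)} {u : R3} {l p q r s : ℝ}

theorem InGroup.planar_of_unit (hiso : SpatialIsotropy G) (hu : ‖u‖ = 1) {u' : R3}
    (hu' : ‖u'‖ = 1) (h : InGroup G (planar u l p q r s)) : InGroup G (planar u' l p q r s) := by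
  obtain ⟨n, hn, rfl⟩ := exists_halfTurn_eq hu hu'
  rw [← conj_planar hn]
  have hS := hiso _ (halfTurn_mem hn)
  exact (hS.comp h).comp hS

/-- A half-turn about an axis orthogonal to u reverses u, and so plays the role of a reflection of
the plane of u and time. -/
theorem InGroup.planar_neg (hiso : SpatialIsotropy G) (hu : ‖u‖ = 1)
    (h : InGroup G (planar u l p q r s)) : InGroup G (planar u l p (-q) (-r) s) := by
  rw [← Relativity.planar_neg]
  exact h.planar_of_unit hiso hu (by rwa [norm_neg])

namespace KinematicGroup

theorem planar_pos (hK : KinematicGroup G) (hu : ‖u‖ = 1) (hl : l ≠ 0)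
    (h : InGroup G (planar u l p q r s)) : 0 < p ∧ 0 < s := by
  constructor
  · have h1 := hK.det_pos _ h
    have h2 : (ContinuousLinearMap.fst ℝ R3 ℝ).comp
        ((planar u l p q r s).comp (ContinuousLinearMap.inl ℝ R3 ℝ)) =
          act (l • 1 + (p - l) • Matrix.vecMulVec u u) := by
      refine ContinuousLinearMap.ext fun x => ?_
      simp [planar, blockMap_apply]
    rw [h2, det_act, det_smul_one_add_vecMulVec hu hl] at h1
    exact (mul_pos_iff_of_pos_left (by positivity)).1 h1
  · have := hK.time_pos _ h
    rwa [planar_apply_time] at this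

theorem isSpecial_planar (hK : KinematicGroup G) (hu : ‖u‖ = 1) (hl : 0 < l)
    (h : InGroup G (planar u l p q r s)) : ∃ v, IsSpecial u v (planar u l p q r s) := by
  obtain ⟨hp, hs⟩ := hK.planar_pos hu hl.ne' h
  -- The lower left block b V of a special transformation vanishes with V. A planar element with q =
  -- 0 obeys this because it is at rest, hence a rotation.
  have hr : q = 0 → r = 0 := by
    rintro rfl
    obtain ⟨S, hS, h1⟩ := hK.eq_rotation _ h (by simp [planar_apply_time])
    have h2 := congrArg Prod.snd (DFunLike.congr_fun h1 ((1 : ℝ) • u, 0))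
    rw [planar_apply_plane hu, spatialRotation_apply] at h2
    simpa using h2
  -- These values solve lam = l, lam a = p, -lam a v = q, lam b v = r, lam α = s. For q = 0 division
  -- by zero gives b = 0, which is right since r = 0.
  refine ⟨-(q / p), isSpecial_iff.2 ⟨p / l, -(r * p / (l * q)), s / l, l, by positivity,
    by positivity, hl, ?_⟩⟩
  have hl' := hl.ne'
  have hp' := hp.ne'
  rcases eq_or_ne q 0 with hq | hq
  · rw [hr hq, hq]
    congr 1 <;> field_simp
  · congr 1 <;> field_simp

/-- The determinant p s - q r is nonzero, as otherwise (q u, -p) would be in the kernel. It is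
positive because the inverse, again in the group, has the positive entry s divided by it. -/
theorem planar_inverse (hK : KinematicGroup G) (hu : ‖u‖ = 1) (hl : 0 < l)
    (h : InGroup G (planar u l p q r s)) : 0 < p * s - q * r ∧
      InGroup G (planar u l⁻¹ (s / (p * s - q * r)) (-(q / (p * s - q * r)))
        (-(r / (p * s - q * r))) (p / (p * s - q * r))) := by
  obtain ⟨hp, hs⟩ := hK.planar_pos hu hl.ne' h
  set D := p * s - q * r with hD
  have hD0 : D ≠ 0 := by
    intro h0
    have h1 : planar u l p q r s (q • u, -p) = planar u l p q r s 0 := by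
      rw [planar_apply_plane hu, map_zero]
      refine Prod.ext ?_ ?_
      · simp only [Prod.fst_zero]
        rw [show p * q + q * -p = 0 by ring, zero_smul]
      · simp only [Prod.snd_zero]
        linarith
    have h2 := congrArg Prod.snd (h.injective h1)
    simp only [Prod.snd_zero] at h2
    linarith
  obtain ⟨M, hM, -, hLM⟩ := hK.exists_inverse h
  have hMeq : M = planar u l⁻¹ (s / D) (-(q / D)) (-(r / D)) (p / D) := by
    refine ContinuousLinearMap.ext fun x => h.injective ?_
    have h1 : (planar u l p q r s).comp (planar u l⁻¹ (s / D) (-(q / D)) (-(r / D)) (p / D)) =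
        ContinuousLinearMap.id ℝ R4 := by
      rw [planar_comp hu, ← planar_one u]
      congr 1 <;> field_simp <;> linarith
    rw [hLM]
    exact (DFunLike.congr_fun h1 x).symm
  rw [hMeq] at hM
  obtain ⟨h1, -⟩ := hK.planar_pos hu (inv_ne_zero hl.ne') hM
  exact ⟨(div_pos_iff_of_pos_left hs).1 h1, hM⟩

end KinematicGroup

/-- An interval of velocities that is closed under the doubling `v ↦ 2 v / (1 + κ v²)` contains
all velocities `w > 0` with `κ w² < 1`. -/
theorem mem_of_doubling {I : Set ℝ} (hI : I.OrdConnected) (h0 : (0 : ℝ) ∈ I) {κ v₀ : ℝ}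
    (hv₀ : v₀ ∈ I) (hpos : 0 < v₀)
    (hdouble : ∀ v ∈ I, 0 < v → 0 < 1 + κ * v ^ 2 ∧ 2 * v / (1 + κ * v ^ 2) ∈ I)
    {w : ℝ} (hw : 0 < w) (hκ : κ * w ^ 2 < 1) : w ∈ I := by
  by_contra hwI
  have hlt : ∀ v ∈ I, v < w := fun v hv => by
    by_contra h
    exact hwI (hI.out h0 hv ⟨hw.le, not_lt.1 h⟩)
  -- Velocities below w satisfy κ v² ≤ m < 1, so each doubling multiplies them by at least 2 / (1 +
  -- m) > 1; this geometric growth must pass w.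
  set m := max (κ * w ^ 2) 0 with hm
  have hm0 : 0 ≤ m := le_max_right _ _
  have hm1 : m < 1 := max_lt hκ one_pos
  have hρ : 1 < 2 / (1 + m) := by rw [lt_div_iff₀ (by linarith)]; linarith
  have hseq : ∀ n : ℕ, ∃ v ∈ I, (2 / (1 + m)) ^ n * v₀ ≤ v := by
    intro n
    induction n with
    | zero => exact ⟨v₀, hv₀, by simp⟩
    | succ n ih =>
      obtain ⟨v, hv, hle⟩ := ih
      have hv0 : 0 < v := lt_of_lt_of_le (by positivity) hle
      obtain ⟨h1, h2⟩ := hdouble v hv hv0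
      refine ⟨_, h2, ?_⟩
      have h3 : κ * v ^ 2 ≤ m := by
        rcases le_or_gt κ 0 with hk | hk
        · exact (mul_nonpos_of_nonpos_of_nonneg hk (sq_nonneg v)).trans hm0
        · have := pow_le_pow_left₀ hv0.le (hlt v hv).le 2
          exact (mul_le_mul_of_nonneg_left this hk.le).trans (le_max_left _ _)
      calc (2 / (1 + m)) ^ (n + 1) * v₀ = 2 / (1 + m) * ((2 / (1 + m)) ^ n * v₀) := by ring
        _ ≤ 2 / (1 + m) * v := by gcongr
        _ = 2 * v / (1 + m) := by ring
        _ ≤ 2 * v / (1 + κ * v ^ 2) := by gcongr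
  obtain ⟨n, hn⟩ := pow_unbounded_of_one_lt (w / v₀) hρ
  obtain ⟨v, hv, hle⟩ := hseq n
  rw [div_lt_iff₀ hpos] at hn
  linarith [hlt v hv]

end Kinematic

/-! ### Boosts -/

/-- The Lorentz factor `1 / √(1 - κ v²)`. -/
def gamma (κ v : ℝ) : ℝ := (√(1 - κ * v ^ 2))⁻¹

/-- The boost with velocity `v u`; `κ = 0` gives the Galilean boosts and `κ = 1 / c²` the Lorentz
boosts with speed parameter `c`. -/
def boost (κ : ℝ) (u : R3) (v : ℝ) : R4 →L[ℝ] R4 :=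
  planar u 1 (gamma κ v) (-(gamma κ v * v)) (-(κ * gamma κ v * v)) (gamma κ v)

theorem gamma_pos {κ v : ℝ} (h : κ * v ^ 2 < 1) : 0 < gamma κ v :=
  inv_pos.2 (Real.sqrt_pos.2 (by linarith))

theorem gamma_sq {κ v : ℝ} (h : κ * v ^ 2 < 1) : gamma κ v ^ 2 * (1 - κ * v ^ 2) = 1 := by
  have h0 : 0 < 1 - κ * v ^ 2 := by linarith
  rw [gamma, inv_pow, Real.sq_sqrt h0.le, inv_mul_cancel₀ h0.ne']

theorem eq_gamma {κ v p : ℝ} (hp : 0 < p) (h : p ^ 2 * (1 - κ * v ^ 2) = 1) :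
    κ * v ^ 2 < 1 ∧ p = gamma κ v := by
  have h1 : 0 < 1 - κ * v ^ 2 := by
    by_contra hn
    nlinarith [mul_nonneg (sq_nonneg p) (neg_nonneg.2 (not_lt.1 hn))]
  have h2 : κ * v ^ 2 < 1 := by linarith
  have h3 := gamma_sq h2
  refine ⟨h2, ?_⟩
  have h4 : p ^ 2 = gamma κ v ^ 2 := mul_right_cancel₀ h1.ne' (h.trans h3.symm)
  exact (pow_left_inj₀ hp.le (gamma_pos h2).le two_ne_zero).1 h4

/-- An involution of an interval `I` around `0` that is continuous and preserves the sign is the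
identity on the positive part of `I`. -/
theorem involution_eq_self {I : Set ℝ} (hI : I.OrdConnected) (h0 : (0 : ℝ) ∈ I) {σ : ℝ → ℝ}
    (hc : ContinuousOn σ I) (hmaps : ∀ v ∈ I, σ v ∈ I) (hinv : ∀ v ∈ I, σ (σ v) = v)
    (hσ0 : σ 0 = 0) (hpos : ∀ v ∈ I, 0 < v → 0 < σ v) {v : ℝ} (hv : v ∈ I) (hv0 : 0 < v) :
    σ v = v := by
  have hσv := hpos v hv hv0
  have hm : max v (σ v) ∈ I := by
    rcases max_choice v (σ v) with h | h <;> rw [h]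
    exacts [hv, hmaps v hv]
  have hm0 : 0 < max v (σ v) := lt_max_of_lt_left hv0
  have hsub : Icc 0 (max v (σ v)) ⊆ I := hI.out h0 hm
  have hinj : InjOn σ I := fun a ha b hb hab => by rw [← hinv a ha, hab, hinv b hb]
  -- A continuous injection with σ 0 ≤ σ (max v (σ v)) is increasing there, and an increasing
  -- involution fixes every point: σ v < v would give v = σ (σ v) < σ v.
  have hmono := (hc.mono hsub).strictMonoOn_of_injOn_Icc hm0.le
    (by rw [hσ0]; exact (hpos _ hm hm0).le) (hinj.mono hsub)
  have hvm : v ∈ Icc 0 (max v (σ v)) := ⟨hv0.le, le_max_left _ _⟩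
  have hσm : σ v ∈ Icc 0 (max v (σ v)) := ⟨hσv.le, le_max_right _ _⟩
  rcases lt_trichotomy (σ v) v with h | h | h
  · have := hmono hσm hvm h
    rw [hinv v hv] at this
    linarith
  · exact h
  · have := hmono hvm hσm h
    rw [hinv v hv] at this
    linarith

/-- The velocities of the special transformations in a fixed direction, and the parameters of
these transformations. -/
structure SpecialFamily (G : Subgroup (Equiv.Perm R4)) (u : R3) (I : Set ℝ)
    (l p r s : ℝ → ℝ) : Prop where
  isOpen : IsOpen I
  ordConnected : I.OrdConnected
  zero_mem : (0 : ℝ) ∈ I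
  continuousOn : ContinuousOn (fun v => p v * v / s v) I
  mem : ∀ v ∈ I, InGroup G (planar u (l v) (p v) (-(p v * v)) (r v) (s v))
  pos : ∀ v ∈ I, 0 < l v ∧ 0 < p v ∧ 0 < s v
  unique : ∀ l' p' q' r' s', 0 < l' → InGroup G (planar u l' p' q' r' s') → ∀ v, q' = -(p' * v) →
    v ∈ I ∧ l' = l v ∧ p' = p v ∧ r' = r v ∧ s' = s v

/-! ### Reciprocity, composition and the universal constant -/

section

variable {G : Subgroup (Equiv.Perm R4)} {u : R3}

/-- Since B v sends (v u, 1) to the time axis, its upper right entry is -p v. Conversely a planar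
element of the group with l > 0 is special, so it is a value of B, and its velocity tells which one.
-/
theorem KinematicGroup.exists_specialFamily (hK : KinematicGroup G)
    (hspec : SpecialTransformations G) :
    ∃ (u : R3) (I : Set ℝ) (l p r s : ℝ → ℝ), ‖u‖ = 1 ∧ SpecialFamily G u I l p r s := by
  obtain ⟨u, hu, I, B, hIo, hIc, hI0, hBd, hB, -, hBI⟩ := hspec
  have hu0 : u ≠ 0 := by rintro rfl; simp at hu
  have hvel : ∀ v ∈ I, ∀ l p q r s : ℝ, B v = planar u l p q r s → q = -(p * v) := by
    intro v hv l p q r s h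
    obtain ⟨A, k, α, -, -, hA⟩ := (hB v hv).2
    have h1 : (B v (v • u, 1)).1 = 0 := by
      rw [hA, blockMap_apply]
      simp
    rw [h, planar_apply_plane hu] at h1
    have := (smul_eq_zero.1 h1).resolve_right hu0
    linarith
  have hex : ∀ v : ℝ, ∃ l p r s : ℝ, v ∈ I →
      (0 < l ∧ 0 < p ∧ 0 < s) ∧ B v = planar u l p (-(p * v)) r s := by
    intro v
    by_cases hv : v ∈ I
    · have : B v ∈ B '' I := mem_image_of_mem B hv
      rw [hBI] at this
      obtain ⟨-, v', hv'⟩ := this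
      obtain ⟨a, b, α, lam, ha, hα, hlam, h⟩ := isSpecial_iff.1 hv'
      refine ⟨lam, lam * a, lam * b * v', lam * α, fun _ => ⟨⟨hlam, mul_pos hlam ha, mul_pos hlam hα⟩, ?_⟩⟩
      rw [← hvel v hv _ _ _ _ _ h]
      exact h
    · exact ⟨0, 0, 0, 0, fun h => absurd h hv⟩
  choose l p r s hlprs using hex
  refine ⟨u, I, l, p, r, s, hu, hIo, hIc, hI0, ?_, ?_, fun v hv => (hlprs v hv).1, ?_⟩
  · have hcont : ContinuousOn (fun v => -⟪u, (B v (0, 1)).1⟫ / (B v (0, 1)).2) I := by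
      have hBc : ContinuousOn (fun v => B v ((0, 1) : R4)) I :=
        hBd.continuousOn.clm_apply continuousOn_const
      refine ContinuousOn.div ?_ hBc.snd fun v hv => ?_
      · exact (continuousOn_const.inner hBc.fst).neg
      · rw [(hlprs v hv).2, planar_apply_time]
        exact (hlprs v hv).1.2.2.ne'
    refine hcont.congr fun v hv => ?_
    simp only
    rw [(hlprs v hv).2, planar_apply_time, inner_smul_right, inner_self_of_unit hu]
    simp
  · intro v hv
    rw [← (hlprs v hv).2]
    exact (hB v hv).1
  · intro l' p' q' r' s' hl' h v hq
    have hp' := (hK.planar_pos hu hl'.ne' h).1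
    have hmem : planar u l' p' q' r' s' ∈ B '' I := by
      rw [hBI]
      exact ⟨h, hK.isSpecial_planar hu hl' h⟩
    obtain ⟨v', hv', hBv⟩ := hmem
    have hvv : v' = v := by
      have := hvel v' hv' _ _ _ _ _ hBv
      rw [hq, neg_inj] at this
      exact (mul_left_cancel₀ hp'.ne' this).symm
    subst hvv
    rw [(hlprs v' hv').2] at hBv
    obtain ⟨h1, h2, -, h4, h5⟩ := planar_inj hu hBv
    exact ⟨hv', h1.symm, h2.symm, h4.symm, h5.symm⟩

namespace SpecialFamily

variable {I : Set ℝ} {l p r s : ℝ → ℝ}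

theorem neg_mem (hF : SpecialFamily G u I l p r s) (hiso : SpatialIsotropy G) (hu : ‖u‖ = 1)
    {v : ℝ} (hv : v ∈ I) :
    -v ∈ I ∧ l v = l (-v) ∧ p v = p (-v) ∧ -r v = r (-v) ∧ s v = s (-v) :=
  hF.unique _ _ _ _ _ (hF.pos v hv).1 ((hF.mem v hv).planar_neg hiso hu) (-v) (by ring)

/-- Reciprocity: the special transformation with the velocity of the reversed inverse. -/
theorem reversed_inverse (hF : SpecialFamily G u I l p r s) (hK : KinematicGroup G)
    (hiso : SpatialIsotropy G) (hu : ‖u‖ = 1) {v : ℝ} (hv : v ∈ I) :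
    0 < p v * s v + p v * v * r v ∧ p v * v / s v ∈ I ∧
      (l v)⁻¹ = l (p v * v / s v) ∧
      s v / (p v * s v + p v * v * r v) = p (p v * v / s v) ∧
      p v / (p v * s v + p v * v * r v) = s (p v * v / s v) := by
  obtain ⟨hl, hp, hs⟩ := hF.pos v hv
  obtain ⟨hD, hM⟩ := hK.planar_inverse hu hl (hF.mem v hv)
  rw [show p v * s v - -(p v * v) * r v = p v * s v + p v * v * r v by ring] at hD hM
  -- The inverse has upper entries s / D and p v / D; after reversal of u its velocity is their
  -- quotient p v / s.
  have h := hF.unique _ _ _ _ _ (inv_pos.2 hl) (hM.planar_neg hiso hu) (p v * v / s v) (by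
    field_simp)
  exact ⟨hD, h.1, h.2.1, h.2.2.1, h.2.2.2.2⟩

/-- Reversing the inverse twice gives back the original map, so v ↦ p v / s is an involution, and by
`involution_eq_self` the identity for v > 0. Then s = p, l is its own inverse, and the determinant
is 1. -/
theorem parameters_of_pos (hF : SpecialFamily G u I l p r s) (hK : KinematicGroup G)
    (hiso : SpatialIsotropy G) (hu : ‖u‖ = 1) {v : ℝ} (hv : v ∈ I) (hv0 : 0 < v) :
    l v = 1 ∧ s v = p v ∧ p v ^ 2 + p v * v * r v = 1 := by
  have hσ : p v * v / s v = v := by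
    refine involution_eq_self (σ := fun v => p v * v / s v) hF.ordConnected hF.zero_mem
      hF.continuousOn (fun v hv => (hF.reversed_inverse hK hiso hu hv).2.1) ?_ (by simp) ?_ hv hv0
    · intro v hv
      obtain ⟨hl, hp, hs⟩ := hF.pos v hv
      obtain ⟨hD, -, -, h1, h2⟩ := hF.reversed_inverse hK hiso hu hv
      rw [← h1, ← h2]
      generalize p v * s v + p v * v * r v = D at hD
      field_simp
    · intro v hv hv0
      obtain ⟨hl, hp, hs⟩ := hF.pos v hv
      positivity
  obtain ⟨hl, hp, hs⟩ := hF.pos v hv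
  obtain ⟨hD, -, h0, h1, -⟩ := hF.reversed_inverse hK hiso hu hv
  rw [hσ] at h0 h1
  have hsp : s v = p v := by
    rw [div_eq_iff hs.ne', mul_comm v] at hσ
    exact (mul_right_cancel₀ hv0.ne' hσ).symm
  refine ⟨?_, hsp, ?_⟩
  · have h2 := mul_inv_cancel₀ hl.ne'
    rw [h0] at h2
    nlinarith
  · rw [hsp, div_eq_iff (by rw [hsp] at hD; exact hD.ne')] at h1
    have := mul_left_cancel₀ hp.ne' ((mul_one _).trans h1)
    linarith

theorem parameters (hF : SpecialFamily G u I l p r s) (hK : KinematicGroup G)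
    (hiso : SpatialIsotropy G) (hu : ‖u‖ = 1) {v : ℝ} (hv : v ∈ I) :
    l v = 1 ∧ s v = p v ∧ p v ^ 2 + p v * v * r v = 1 := by
  rcases lt_trichotomy v 0 with h | rfl | h
  · obtain ⟨h0, h1, h2, h3, h4⟩ := hF.neg_mem hiso hu hv
    obtain ⟨e1, e2, e3⟩ := hF.parameters_of_pos hK hiso hu h0 (by linarith)
    rw [h1, h2, h4, e1, e2]
    refine ⟨rfl, rfl, ?_⟩
    rw [← h3] at e3
    linarith
  · obtain ⟨-, h1, h2, h3, h4⟩ := hF.unique 1 1 0 0 1 one_pos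
      (by rw [planar_one]; exact inGroup_id) 0 (by simp)
    rw [← h1, ← h2, ← h4]
    norm_num
  · exact hF.parameters_of_pos hK hiso hu hv h

/-- The law of composition of special transformations. -/
theorem composition (hF : SpecialFamily G u I l p r s) (hK : KinematicGroup G)
    (hiso : SpatialIsotropy G) (hu : ‖u‖ = 1) {v w : ℝ} (hv : v ∈ I) (hw : w ∈ I) :
    v * p v * r w = w * p w * r v ∧ 0 < p v * p w - p v * v * r w ∧
      p v * p w * (v + w) / (p v * p w - p v * v * r w) ∈ I := by
  obtain ⟨lv, sv, -⟩ := hF.parameters hK hiso hu hv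
  obtain ⟨lw, sw, -⟩ := hF.parameters hK hiso hu hw
  have h := (hF.mem v hv).comp (hF.mem w hw)
  rw [planar_comp hu, lv, lw, sv, sw, one_mul] at h
  have hpos := (hK.planar_pos hu one_ne_zero h).1
  have hu := hF.unique _ _ _ _ _ one_pos h
    (p v * p w * (v + w) / (p v * p w - p v * v * r w)) (by
      rw [show p v * p w + -(p v * v) * r w = p v * p w - p v * v * r w by ring] at hpos ⊢
      rw [mul_div_cancel₀ _ hpos.ne']
      ring)
  obtain ⟨hmem, -, h1, -, h2⟩ := hu
  -- The product is itself special, so its two diagonal entries agree; this is the symmetric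
  -- relation between v and w.
  obtain ⟨-, h3, -⟩ := hF.parameters hK hiso ‹_› hmem
  refine ⟨by linarith, by linarith, hmem⟩

/-- By the composition law r / (p v) is the same for all nonzero v, say -κ; determinant 1 then makes
p the Lorentz factor, and doubling fills the range κ v² < 1. -/
theorem exists_boost (hF : SpecialFamily G u I l p r s) (hK : KinematicGroup G)
    (hiso : SpatialIsotropy G) (hu : ‖u‖ = 1) :
    ∃ κ : ℝ, 0 ≤ κ ∧ ∀ v, κ * v ^ 2 < 1 → InGroup G (boost κ u v) := by
  obtain ⟨v₀, hv₀, hpos⟩ : ∃ v₀ ∈ I, 0 < v₀ := by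
    obtain ⟨ε, hε, hball⟩ := Metric.isOpen_iff.1 hF.isOpen 0 hF.zero_mem
    refine ⟨ε / 2, hball ?_, by positivity⟩
    rw [Metric.mem_ball, Real.dist_eq, sub_zero, abs_of_pos (by positivity)]
    linarith
  have hp₀ := (hF.pos v₀ hv₀).2.1
  set κ := -(r v₀ / (p v₀ * v₀)) with hκ
  have hr : ∀ v ∈ I, r v = -(κ * p v * v) := by
    intro v hv
    have := (hF.composition hK hiso hu hv hv₀).1
    rw [hκ]
    field_simp
    linarith
  have hgamma : ∀ v ∈ I, κ * v ^ 2 < 1 ∧ p v = gamma κ v := by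
    intro v hv
    obtain ⟨-, -, h⟩ := hF.parameters hK hiso hu hv
    rw [hr v hv] at h
    exact eq_gamma (hF.pos v hv).2.1 (by linarith)
  have hdouble : ∀ v ∈ I, 0 < v → 0 < 1 + κ * v ^ 2 ∧ 2 * v / (1 + κ * v ^ 2) ∈ I := by
    intro v hv hv0
    obtain ⟨-, h1, h2⟩ := hF.composition hK hiso hu hv hv
    have hp := (hF.pos v hv).2.1
    rw [hr v hv, show p v * p v - p v * v * -(κ * p v * v) = p v ^ 2 * (1 + κ * v ^ 2) by ring]
      at h1 h2
    have h3 : 0 < 1 + κ * v ^ 2 := (mul_pos_iff_of_pos_left (by positivity)).1 h1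
    refine ⟨h3, ?_⟩
    convert h2 using 1
    field_simp
    ring
  have hall : ∀ w, 0 < w → κ * w ^ 2 < 1 → w ∈ I := fun w hw h =>
    mem_of_doubling hF.ordConnected hF.zero_mem hv₀ hpos hdouble hw h
  refine ⟨κ, ?_, fun v hv => ?_⟩
  · by_contra hneg
    rw [not_le] at hneg
    -- For κ < 0 the map with κ v² = -1 is, in a suitable unit of time, a rotation by 45°. Its
    -- square is a rotation by 90°, which violates positivity of the spatial determinant.
    have h1 : 0 < √(1 / -κ) := Real.sqrt_pos.2 (by rw [one_div, inv_pos]; linarith)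
    have h2 : κ * √(1 / -κ) ^ 2 = -1 := by
      rw [Real.sq_sqrt (by rw [one_div, inv_nonneg]; linarith)]
      have := hneg.ne
      field_simp
    have := (hdouble _ (hall _ h1 (by rw [h2]; norm_num)) h1).1
    rw [h2] at this
    linarith
  · have hvI : v ∈ I := by
      rcases lt_trichotomy v 0 with h | rfl | h
      · have := (hF.neg_mem hiso hu (hall (-v) (by linarith) (by simpa using hv))).1
        rwa [neg_neg] at this
      · exact hF.zero_mem
      · exact hall v h hv
    have h := hF.mem v hvI
    obtain ⟨h1, h2, -⟩ := hF.parameters hK hiso hu hvI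
    rw [h1, h2, hr v hvI, (hgamma v hvI).2] at h
    exact h

end SpecialFamily

end

/-! ### The structure group is generated by rotations, boosts and translations -/

theorem exists_smul_unit (V : R3) : ∃ (u : R3) (v : ℝ), ‖u‖ = 1 ∧ V = v • u := by
  rcases eq_or_ne V 0 with rfl | hV
  · obtain ⟨n, hn, -⟩ := exists_unit_orthogonal 0
    exact ⟨n, 0, hn, by simp⟩
  · have h0 : ‖V‖ ≠ 0 := norm_ne_zero_iff.2 hV
    exact ⟨‖V‖⁻¹ • V, ‖V‖, norm_smul_inv_norm (𝕜 := ℝ) hV, by rw [smul_inv_smul₀ h0]⟩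

theorem norm_smul_unit_sq {u : R3} (hu : ‖u‖ = 1) (v : ℝ) : ‖v • u‖ ^ 2 = v ^ 2 := by
  rw [norm_smul, hu, mul_one, Real.norm_eq_abs, sq_abs]

theorem boost_neg_comp_boost {u : R3} (hu : ‖u‖ = 1) {κ v : ℝ} (h : κ * v ^ 2 < 1) :
    (boost κ u (-v)).comp (boost κ u v) = ContinuousLinearMap.id ℝ R4 := by
  have hg := gamma_sq h
  have hneg : gamma κ (-v) = gamma κ v := by simp [gamma]
  rw [boost, boost, planar_comp hu, hneg, ← planar_one u]
  congr 1 <;> linarith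

theorem boost_neg_apply_time {u : R3} (κ v : ℝ) :
    boost κ u (-v) (0, 1) = gamma κ v • ((v • u, 1) : R4) := by
  have hneg : gamma κ (-v) = gamma κ v := by simp [gamma]
  rw [boost, planar_apply_time, hneg]
  ext <;> simp [mul_assoc]

/-! ### The velocity bound and the normal form -/

section

variable {G : Subgroup (Equiv.Perm R4)} {κ : ℝ} {L : R4 →L[ℝ] R4}

namespace KinematicGroup

theorem eq_zero_of_spatial_eq_zero (hK : KinematicGroup G) (hL : InGroup G L) {r : R3}
    (h : (L (r, 0)).1 = 0) : r = 0 := by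
  set A := (ContinuousLinearMap.fst ℝ R3 ℝ).comp (L.comp (ContinuousLinearMap.inl ℝ R3 ℝ)) with hA
  have hdet : (A : R3 →ₗ[ℝ] R3).det ≠ 0 := (hK.det_pos L hL).ne'
  have hker := (LinearMap.equivOfDetNeZero (A : R3 →ₗ[ℝ] R3) hdet).injective
  apply hker
  rw [map_zero]
  exact h

/-- If κ|V|² > 1, the boost along V with velocity -1/(κ|V|) is admissible and sends the spatial
vector V/|V| to a multiple of (V,1). Its composite with L would then have a singular spatial block.
-/
theorem velocity_le (hK : KinematicGroup G) (hκ : 0 ≤ κ)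
    (hboost : ∀ u, ‖u‖ = 1 → ∀ v, κ * v ^ 2 < 1 → InGroup G (boost κ u v)) (hL : InGroup G L)
    {V : R3} (hV : (L (V, 1)).1 = 0) : κ * ‖V‖ ^ 2 ≤ 1 := by
  by_contra hgt
  rw [not_le] at hgt
  have hV0 : V ≠ 0 := by rintro rfl; norm_num at hgt
  have hκ0 : κ ≠ 0 := by rintro rfl; norm_num at hgt
  set w := ‖V‖ with hw
  have hw0 : w ≠ 0 := norm_ne_zero_iff.2 hV0
  have hunit : ‖w⁻¹ • V‖ = 1 := norm_smul_inv_norm (𝕜 := ℝ) hV0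
  have hv : κ * (-(1 / (κ * w))) ^ 2 < 1 := by
    have : κ * (-(1 / (κ * w))) ^ 2 = 1 / (κ * w ^ 2) := by field_simp
    rw [this, div_lt_one (by linarith)]
    exact hgt
  have hB := hL.comp (hboost _ hunit _ hv)
  have h0 := hK.eq_zero_of_spatial_eq_zero hB (r := (1 : ℝ) • w⁻¹ • V) (by
    rw [ContinuousLinearMap.comp_apply, boost, planar_apply_plane hunit]
    set g := gamma κ (-(1 / (κ * w))) with hg
    have : (((g * 1 + -(g * -(1 / (κ * w))) * 0) • w⁻¹ • V,
        -(κ * g * -(1 / (κ * w))) * 1 + g * 0) : R4) = (g / w) • ((V, 1) : R4) := by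
      refine Prod.ext ?_ ?_
      · simp only [Prod.smul_fst]
        module
      · simp only [Prod.smul_snd, smul_eq_mul]
        field_simp
        ring
    rw [this, map_smul, Prod.smul_fst, hV, smul_zero])
  rw [one_smul, smul_eq_zero, inv_eq_zero] at h0
  exact h0.elim hw0 hV0

/-- A velocity on the boundary could be enlarged slightly, since velocities form an open set,
contradicting `velocity_le`. -/
theorem velocity_lt (hK : KinematicGroup G) (hκ : 0 ≤ κ)
    (hboost : ∀ u, ‖u‖ = 1 → ∀ v, κ * v ^ 2 < 1 → InGroup G (boost κ u v)) (hL : InGroup G L)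
    {V : R3} (hV : (L (V, 1)).1 = 0) : κ * ‖V‖ ^ 2 < 1 := by
  refine lt_of_le_of_ne (hK.velocity_le hκ hboost hL hV) fun heq => ?_
  have hnhds : ∀ᶠ ε : ℝ in 𝓝 0, (1 + ε) • V ∈ {V : R3 | ∃ L, InGroup G L ∧ (L (V, 1)).1 = 0} := by
    have hc : Continuous fun ε : ℝ => (1 + ε) • V := by fun_prop
    apply hc.continuousAt.eventually_mem
    apply hK.isOpen_velocities.mem_nhds
    exact ⟨L, hL, by simpa using hV⟩
  obtain ⟨δ, hδ, hball⟩ := Metric.eventually_nhds_iff.1 hnhds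
  obtain ⟨L', hL', hV'⟩ := hball (y := δ / 2) (by
    rw [Real.dist_eq, sub_zero, abs_of_pos (by positivity)]
    linarith)
  have h1 := hK.velocity_le hκ hboost hL' hV'
  rw [norm_smul, mul_pow, Real.norm_eq_abs, sq_abs] at h1
  nlinarith

/-- The velocity of L is read off from the image of the time axis under its inverse. Precomposing
with the opposite boost brings L to rest, and elements at rest are rotations. -/
theorem exists_rotation_boost (hK : KinematicGroup G) (hκ : 0 ≤ κ)
    (hboost : ∀ u, ‖u‖ = 1 → ∀ v, κ * v ^ 2 < 1 → InGroup G (boost κ u v)) (hL : InGroup G L) :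
    ∃ S ∈ SO3, ∃ (u : R3) (v : ℝ), ‖u‖ = 1 ∧ κ * v ^ 2 < 1 ∧
      L = (spatialRotation S).comp (boost κ u v) := by
  obtain ⟨M, hM, hML, hLM⟩ := hK.exists_inverse hL
  have hpos := hK.time_pos M hM
  set α := (M (0, 1)).2 with hα
  obtain ⟨u, v, hu, huv⟩ := exists_smul_unit (α⁻¹ • (M (0, 1)).1)
  have hV : (L (v • u, 1)).1 = 0 := by
    have : ((v • u, 1) : R4) = α⁻¹ • M (0, 1) := by
      rw [← huv]
      refine Prod.ext rfl ?_
      simp only [Prod.smul_snd, smul_eq_mul]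
      rw [← hα, inv_mul_cancel₀ hpos.ne']
    rw [this, map_smul, hLM]
    simp
  have hv := hK.velocity_lt hκ hboost hL hV
  rw [norm_smul_unit_sq hu] at hv
  have hN := hL.comp (hboost u hu (-v) (by simpa using hv))
  obtain ⟨S, hS, hNS⟩ := hK.eq_rotation _ hN (by
    rw [ContinuousLinearMap.comp_apply, boost_neg_apply_time, map_smul, Prod.smul_fst, hV,
      smul_zero])
  refine ⟨S, hS, u, v, hu, hv, ?_⟩
  rw [← hNS, ContinuousLinearMap.comp_assoc, boost_neg_comp_boost hu hv,
    ContinuousLinearMap.comp_id]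

theorem mem_iff (hK : KinematicGroup G) (hiso : SpatialIsotropy G) (hκ : 0 ≤ κ)
    (hboost : ∀ u, ‖u‖ = 1 → ∀ v, κ * v ^ 2 < 1 → InGroup G (boost κ u v))
    (g : Equiv.Perm R4) :
    g ∈ G ↔ ∃ S ∈ SO3, ∃ (u : R3) (v : ℝ) (b : R4), ‖u‖ = 1 ∧ κ * v ^ 2 < 1 ∧
      ∀ x, g x = spatialRotation S (boost κ u v x) + b := by
  constructor
  · intro hg
    obtain ⟨L, b, hgL⟩ := hK.affine g hg
    obtain ⟨S, hS, u, v, hu, hv, h⟩ := hK.exists_rotation_boost hκ hboost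
      (InGroup.of_affine hK.translation_mem hg hgL)
    exact ⟨S, hS, u, v, b, hu, hv, fun x => by rw [hgL, h]; rfl⟩
  · rintro ⟨S, hS, u, v, b, hu, hv, h⟩
    exact hK.mem_of_affine ((hiso S hS).comp (hboost u hu v hv)) h

theorem exists_boosts (hK : KinematicGroup G) (hiso : SpatialIsotropy G)
    (hspec : SpecialTransformations G) :
    ∃ κ : ℝ, 0 ≤ κ ∧ ∀ u, ‖u‖ = 1 → ∀ v, κ * v ^ 2 < 1 → InGroup G (boost κ u v) := by
  obtain ⟨u, I, l, p, r, s, hu, hF⟩ := hK.exists_specialFamily hspec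
  obtain ⟨κ, hκ, h⟩ := hF.exists_boost hK hiso hu
  exact ⟨κ, hκ, fun u' hu' v hv => (h v hv).planar_of_unit hiso hu hu'⟩

end KinematicGroup

end

/-! ### Galilei and Lorentz transformations -/

theorem rotation_boost_zero_eq (S : Matrix (Fin 3) (Fin 3) ℝ) (u : R3) (v : ℝ) (x : R4) :
    spatialRotation S (boost 0 u v x) = blockMap S (-(act S (v • u))) 0 1 x := by
  obtain ⟨r, t⟩ := x
  rw [spatialRotation_apply, boost, planar_apply, blockMap_apply]
  have : gamma 0 v = 1 := by simp [gamma]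
  rw [this]
  refine Prod.ext ?_ (by simp)
  simp only [map_add, map_smul]
  module

theorem mem_galileoGroup_iff (g : Equiv.Perm R4) :
    g ∈ galileoGroup ↔ ∃ S ∈ SO3, ∃ (u : R3) (v : ℝ) (b : R4), ‖u‖ = 1 ∧ 0 * v ^ 2 < (1 : ℝ) ∧
      ∀ x, g x = spatialRotation S (boost 0 u v x) + b := by
  constructor
  · rintro ⟨S, hS, V, b, h⟩
    obtain ⟨u, v, hu, rfl⟩ := exists_smul_unit V
    exact ⟨S, hS, u, v, b, hu, by simp, fun x => by rw [h, rotation_boost_zero_eq]⟩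
  · rintro ⟨S, hS, u, v, b, hu, -, h⟩
    exact ⟨S, hS, v • u, b, fun x => by rw [h, rotation_boost_zero_eq]⟩

theorem det_spatialRotation (S : Matrix (Fin 3) (Fin 3) ℝ) : (spatialRotation S).det = S.det := by
  have := det_blockMap_velocity S 0 0 1
  simpa [spatialRotation] using this

theorem det_boost {u : R3} (hu : ‖u‖ = 1) {κ v : ℝ} (h : κ * v ^ 2 < 1) :
    (boost κ u v).det = 1 := by
  set A : Matrix (Fin 3) (Fin 3) ℝ := (1 : ℝ) • 1 + (gamma κ v - 1) • Matrix.vecMulVec u u with hA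
  have hAu : act A (v • u) = (gamma κ v * v) • u := by
    have : ∀ x, act A x = (1 : ℝ) • act 1 x +
        (gamma κ v - 1) • act (Matrix.vecMulVec u u) x := by
      intro x
      simp only [hA, act, map_add, map_smul, add_apply, smul_apply]
    rw [this, act_one_apply, act_vecMulVec_apply, inner_smul_right, inner_self_of_unit hu]
    module
  have hb : boost κ u v = blockMap A (-(act A (v • u))) (-(κ * gamma κ v * v) • u) (gamma κ v) := by
    rw [hAu, boost, planar, neg_smul (gamma κ v * v)]
  rw [hb, det_blockMap_velocity, hA, det_smul_one_add_vecMulVec hu one_ne_zero, inner_smul_left,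
    inner_smul_right, inner_self_of_unit hu, conj_trivial]
  linear_combination gamma_sq h

theorem minkowskiForm_spatialRotation {S : Matrix (Fin 3) (Fin 3) ℝ} (hS : S ∈ SO3) (c : ℝ)
    (x : R4) : minkowskiForm c (spatialRotation S x) = minkowskiForm c x := by
  rw [spatialRotation_apply, minkowskiForm, minkowskiForm, norm_act hS]

theorem minkowskiForm_boost {u : R3} (hu : ‖u‖ = 1) {κ c v : ℝ} (hc : κ * c ^ 2 = 1)
    (h : κ * v ^ 2 < 1) (x : R4) : minkowskiForm c (boost κ u v x) = minkowskiForm c x := by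
  obtain ⟨r, t⟩ := x
  have hg := gamma_sq h
  rw [boost, planar_apply, minkowskiForm, minkowskiForm]
  simp only
  rw [norm_add_sq_real, one_smul, inner_smul_right, norm_smul_unit_sq hu, real_inner_comm u r]
  set g := gamma κ v
  set a := ⟪u, r⟫
  linear_combination (a ^ 2 - c ^ 2 * t ^ 2) * hg +
    (-(g ^ 2 * κ * v ^ 2 * a ^ 2) + 2 * g ^ 2 * a * v * t - g ^ 2 * v ^ 2 * t ^ 2) * hc

/-! ### Lorentz transformations as a rotation after a boost -/

section Lorentz

variable {L : R4 →L[ℝ] R4} {c : ℝ}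

theorem minkowski_polar (hL : ∀ x, minkowskiForm c (L x) = minkowskiForm c x) (x y : R4) :
    ⟪(L x).1, (L y).1⟫ - c ^ 2 * ((L x).2 * (L y).2) = ⟪x.1, y.1⟫ - c ^ 2 * (x.2 * y.2) := by
  have h1 := hL (x + y)
  have h2 := hL x
  have h3 := hL y
  simp only [minkowskiForm, map_add, Prod.fst_add, Prod.snd_add, norm_add_sq_real] at h1 h2 h3
  linarith

/-- A proper Lorentz transformation that fixes the time axis is a rotation. -/
theorem eq_rotation_of_lorentz (hc : c ≠ 0)
    (hL : ∀ x, minkowskiForm c (L x) = minkowskiForm c x) (hdet : L.det = 1)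
    (h1 : (L (0, 1)).1 = 0) (h2 : 0 < (L (0, 1)).2) : ∃ S ∈ SO3, L = spatialRotation S := by
  have hc2 : c ^ 2 ≠ 0 := pow_ne_zero 2 hc
  have hone : (L (0, 1)).2 = 1 := by
    have := hL (0, 1)
    simp only [minkowskiForm, h1, norm_zero] at this
    have h3 : (L (0, 1)).2 ^ 2 = 1 := mul_left_cancel₀ hc2 (by linarith)
    nlinarith
  -- L preserves the polar form and fixes the time axis, hence preserves its orthogonal complement,
  -- space.
  have hspace : ∀ r : R3, (L (r, 0)).2 = 0 := by
    intro r
    have := minkowski_polar hL (0, 1) (r, 0)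
    simpa [h1, hone, hc] using this
  set S : Matrix (Fin 3) (Fin 3) ℝ := (Matrix.toEuclideanCLM (n := Fin 3) (𝕜 := ℝ)).symm
    ((ContinuousLinearMap.fst ℝ R3 ℝ).comp (L.comp (ContinuousLinearMap.inl ℝ R3 ℝ))) with hS
  have hact : ∀ r : R3, act S r = (L (r, 0)).1 := by
    intro r
    simp [act, hS]
  have hLS : L = spatialRotation S := by
    refine ContinuousLinearMap.ext fun x => ?_
    obtain ⟨r, t⟩ := x
    have : ((r, t) : R4) = (r, 0) + t • ((0, 1) : R4) := by simp
    rw [spatialRotation_apply, this, map_add, map_smul]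
    refine Prod.ext ?_ ?_
    · simp [hact, h1]
    · simp [hspace, hone]
  refine ⟨S, mem_SO3_iff.2 ⟨?_, ?_⟩, hLS⟩
  · rw [mul_eq_one_comm]
    apply (Matrix.toEuclideanCLM (n := Fin 3) (𝕜 := ℝ)).injective
    refine ContinuousLinearMap.ext fun x => ext_inner_left ℝ fun y => ?_
    change ⟪y, act (S.transpose * S) x⟫ = ⟪y, act 1 x⟫
    rw [act_mul_apply, act_one_apply, ← inner_act_left, hact, hact]
    simpa [hspace] using minkowski_polar hL (y, 0) (x, 0)
  · rw [← det_spatialRotation, ← hLS, hdet]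

theorem det_comp (L M : R4 →L[ℝ] R4) : (L.comp M).det = L.det * M.det :=
  LinearMap.det_comp (L : R4 →ₗ[ℝ] R4) M

/-- The preimage y of (0,1) is timelike, so y.1 / y.2 is a velocity with κ v² < 1; undoing it by a
boost leaves a proper Lorentz map that preserves the time axis and its direction. -/
theorem exists_rotation_boost_of_lorentz {κ : ℝ} (hκ : κ * c ^ 2 = 1)
    (hL : ∀ x, minkowskiForm c (L x) = minkowskiForm c x) (hdet : L.det = 1)
    (htime : 0 < (L (0, 1)).2) :
    ∃ S ∈ SO3, ∃ (u : R3) (v : ℝ), ‖u‖ = 1 ∧ κ * v ^ 2 < 1 ∧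
      L = (spatialRotation S).comp (boost κ u v) := by
  have hc : c ≠ 0 := by rintro rfl; norm_num at hκ
  have hc2 : 0 < c ^ 2 := by positivity
  have hκ0 : 0 < κ := by
    by_contra h
    nlinarith
  obtain ⟨y, hy⟩ : ∃ y, L y = (0, 1) :=
    (LinearMap.equivOfDetNeZero (L : R4 →ₗ[ℝ] R4) (by
      change L.det ≠ 0; rw [hdet]; exact one_ne_zero)).surjective (0, 1)
  have hform := hL y
  simp only [hy, minkowskiForm, norm_zero] at hform
  have hy2 : y.2 ≠ 0 := by
    intro h0
    rw [h0] at hform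
    nlinarith [sq_nonneg ‖y.1‖]
  obtain ⟨u, v, hu, huv⟩ := exists_smul_unit (y.2⁻¹ • y.1)
  have hyV : y = y.2 • ((v • u, 1) : R4) := by
    rw [← huv]
    refine Prod.ext ?_ ?_
    · simp [smul_inv_smul₀ hy2]
    · simp
  have hv : κ * v ^ 2 < 1 := by
    have h1 : ‖y.1‖ ^ 2 = y.2 ^ 2 * v ^ 2 := by
      rw [hyV]
      simp only [Prod.smul_fst, Prod.smul_snd, smul_eq_mul, mul_one]
      rw [smul_smul, norm_smul_unit_sq hu, mul_pow]
    rw [h1] at hform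
    have hy2' : 0 < y.2 ^ 2 := by positivity
    have h2 : y.2 ^ 2 * (1 - κ * v ^ 2) = κ * c ^ 2 := by
      linear_combination κ * hform - y.2 ^ 2 * hκ
    have h3 : 0 < 1 - κ * v ^ 2 := by
      rw [hκ] at h2
      exact (mul_pos_iff_of_pos_left hy2').1 (by linarith)
    linarith
  have hLV : L (v • u, 1) = y.2⁻¹ • ((0, 1) : R4) := by
    rw [← hy, ← map_smul, hyV]
    simp only [Prod.smul_snd, smul_eq_mul, mul_one]
    rw [inv_smul_smul₀ hy2]
  -- The polar form of (0,1) with (v u, 1) is -c², so L (0,1) and L (v u, 1) have time components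
  -- with product 1.
  have hpos : 0 < y.2⁻¹ := by
    have h1 := minkowski_polar hL (0, 1) (v • u, 1)
    rw [hLV] at h1
    simp only [Prod.smul_fst, Prod.smul_snd, smul_zero, inner_zero_right, inner_zero_left, zero_sub,
      smul_eq_mul, mul_one, neg_inj] at h1
    have h2 : (L (0, 1)).2 * y.2⁻¹ = 1 := mul_left_cancel₀ hc2.ne' (by linarith)
    exact (mul_pos_iff_of_pos_left htime).1 (by rw [h2]; exact one_pos)
  have hv' : κ * (-v) ^ 2 < 1 := by simpa using hv
  have hN : (L.comp (boost κ u (-v))) (0, 1) = (gamma κ v * y.2⁻¹) • ((0, 1) : R4) := by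
    rw [ContinuousLinearMap.comp_apply, boost_neg_apply_time, map_smul, hLV, smul_smul]
  obtain ⟨S, hS, hNS⟩ := eq_rotation_of_lorentz hc (L := L.comp (boost κ u (-v)))
    (fun x => by rw [ContinuousLinearMap.comp_apply, hL, minkowskiForm_boost hu hκ hv'])
    (by rw [det_comp, hdet, det_boost hu hv', one_mul]) (by rw [hN]; simp)
    (by rw [hN]; simpa using mul_pos (gamma_pos hv) hpos)
  refine ⟨S, hS, u, v, hu, hv, ?_⟩
  rw [← hNS, ContinuousLinearMap.comp_assoc, boost_neg_comp_boost hu hv,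
    ContinuousLinearMap.comp_id]

theorem mem_poincareGroup_iff {κ : ℝ} (hκ : κ * c ^ 2 = 1) (g : Equiv.Perm R4) :
    g ∈ poincareGroup c ↔ ∃ S ∈ SO3, ∃ (u : R3) (v : ℝ) (b : R4), ‖u‖ = 1 ∧ κ * v ^ 2 < 1 ∧
      ∀ x, g x = spatialRotation S (boost κ u v x) + b := by
  constructor
  · rintro ⟨L, b, hL, hdet, htime, h⟩
    obtain ⟨S, hS, u, v, hu, hv, hLS⟩ := exists_rotation_boost_of_lorentz hκ hL hdet htime
    exact ⟨S, hS, u, v, b, hu, hv, fun x => by rw [h, hLS]; rfl⟩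
  · rintro ⟨S, hS, u, v, b, hu, hv, h⟩
    refine ⟨(spatialRotation S).comp (boost κ u v), b, fun x => ?_, ?_, ?_, h⟩
    · rw [ContinuousLinearMap.comp_apply, minkowskiForm_spatialRotation hS,
        minkowskiForm_boost hu hκ hv]
    · rw [det_comp, det_spatialRotation, det_boost hu hv, (mem_SO3_iff.1 hS).2, one_mul]
    · rw [ContinuousLinearMap.comp_apply, spatialRotation_apply, boost, planar_apply_time]
      exact gamma_pos hv

end Lorentz

end Relativity

end

open Relativity
theorem theorem5p1 {E : Type*} (Φ : Set (E ≃ R4)) (hΦ : Φ.Nonempty)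
    (h_diff : DifferentialStructure Φ)
    (h_causality : Causality Φ)
    (h_time : TimeOrientation Φ)
    (h_space : SpatialOrientation Φ)
    (h_rest : MutualRest Φ)
    (G : Subgroup (Equiv.Perm R4)) (hG : IsStructureGroup Φ G)
    (h_velocities : PhysicalVelocities Φ)
    (h_inertiality : Inertiality Φ)
    (h_abundance : Abundance Φ)
    (h_special : SpecialTransformations G)
    (h_isotropy : SpatialIsotropy G) :
    (G : Set (Equiv.Perm R4)) = galileoGroup ∨
      ∃ c : ℝ, 0 < c ∧ (G : Set (Equiv.Perm R4)) = poincareGroup c := by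
  have hK := kinematicGroup_of_axioms h_diff h_causality h_time h_space h_rest hG h_velocities
    h_inertiality h_abundance
  obtain ⟨κ, hκ, hboost⟩ := hK.exists_boosts h_isotropy h_special
  rcases hκ.eq_or_lt with rfl | hpos
  · left
    ext g
    exact (hK.mem_iff h_isotropy le_rfl hboost g).trans (mem_galileoGroup_iff g).symm
  · right
    -- The invariant speed is determined by κ c² = 1.
    refine ⟨√κ⁻¹, by positivity, ?_⟩
    have hc : κ * √κ⁻¹ ^ 2 = 1 := by
      rw [Real.sq_sqrt (by positivity), mul_inv_cancel₀ hpos.ne']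
    ext g
    exact (hK.mem_iff h_isotropy hκ hboost g).trans (mem_poincareGroup_iff hc g).symm
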